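/- For $\alpha>0$ let $L^\alpha$ be the modified fractional Volterra operator on the complex Hilbert space $L_2([0,1])$, $$ L^\alpha f(x)=\frac1{\Gamma(\alpha)}\int_0^x (x-y)^{\alpha-1}e^{y-x}f(y)\,dy . $$ Then $\alpha\mapsto L^\alpha$ is Bochner integrable on $(0,1/2)$ with respect to the operator norm, and the operators $$ A=-\int_0^{1/2}L^\alpha\,d\alpha ,\qquad T=e^A $$ on $L_2([0,1])$ have the following properties. 1. $A\ne0$, $\sigma(A)=\{0\}$, and $\limsup_{t\to\infty} t\,\|Ae^{tA}\|\le 1/e$. 2. $T\ne I$, $\sigma(T)=\{1\}$, and $\limsup_{n\to\infty} n\,\|T^{n+1}-T^n\|\le 1/e$. Consequently the constant $1/e$ cannot be enlarged in Esterle-type theorems: for every real $C>1/e$, neither of the following assertions holds for all bounded operators on all complex Hilbert spaces: (a) if $\sigma(A)=\{0\}$ and $\liminf_{t\to\infty}t\|Ae^{tA}\|<C$, then $A=0$; (b) if $\sigma(T)=\{1\}$ and $\liminf_{n\to\infty}n\|T^{n+1}-T^n\|<C$, then $T=I$. -/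

import Mathlib

open MeasureTheory Filter Topology
open scoped ENNReal

noncomputable section

namespace ModVolterra

/-- Lebesgue measure on `[0,1]`. -/
abbrev unitMeasure : Measure ℝ := volume.restrict (Set.Icc (0 : ℝ) 1)

/-- The complex Hilbert space `L²([0,1])`. -/
abbrev L2 : Type := Lp ℂ 2 unitMeasure

/-- `(L^α f)(x) = Γ(α)⁻¹ ∫_0^x (x-y)^(α-1) e^(y-x) f(y) dy`, as a function of `x`. -/
def fracFun (α : ℝ) (f : ℝ → ℂ) (x : ℝ) : ℂ :=
  (((Real.Gamma α)⁻¹ : ℝ) : ℂ) *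
    ∫ y in (0 : ℝ)..x, (((x - y) ^ (α - 1) * Real.exp (y - x) : ℝ) : ℂ) * f y

/-- The convolution kernel of `L^α`. -/
def ker (α : ℝ) (s : ℝ) : ℝ :=
  if 0 < s then (Real.Gamma α)⁻¹ * (s ^ (α - 1) * Real.exp (-s)) else 0

theorem measurable_ker (α : ℝ) : Measurable (ker α) := by
  unfold ker
  refine Measurable.ite measurableSet_Ioi ?_ measurable_const
  fun_prop

theorem integrable_ker {α : ℝ} (hα : 0 < α) : Integrable (ker α) := by
  have h := (Real.GammaIntegral_convergent hα).const_mul (Real.Gamma α)⁻¹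
  rw [← IntegrableOn, ← integrable_indicator_iff measurableSet_Ioi] at h
  refine h.congr (Eventually.of_forall fun s => ?_)
  by_cases hs : 0 < s
  · simp [ker, hs, Set.indicator, mul_comm]
  · simp [ker, hs, Set.indicator]

theorem fracFun_eq (α : ℝ) (f : ℝ → ℂ) {x : ℝ} (hx : x ∈ Set.Icc (0 : ℝ) 1) :
    fracFun α f x = ∫ y, ((ker α (x - y) : ℝ) : ℂ) * f y ∂unitMeasure := by
  unfold fracFun
  rw [intervalIntegral.integral_of_le hx.1, integral_Ioc_eq_integral_Ioo,
    ← integral_const_mul, ← integral_indicator measurableSet_Ioo, unitMeasure,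
    integral_Icc_eq_integral_Ioc, integral_Ioc_eq_integral_Ioo,
    ← integral_indicator measurableSet_Ioo]
  congr 1
  ext y
  by_cases h0 : 0 < y
  · by_cases h1 : y < x
    · have h2 : y < 1 := h1.trans_le hx.2
      simp [Set.indicator, h0, h1, h2, ker, mul_assoc]
    · simp [Set.indicator, h1, ker]
  · simp [Set.indicator, h0]

theorem enorm_ofReal_eq (r : ℝ) : ‖(r : ℂ)‖ₑ = ‖r‖ₑ := by
  rw [← ofReal_norm, ← ofReal_norm, Complex.norm_real]

/-- Schur test for a convolution kernel. -/
theorem schur {k : ℝ → ℝ} (hk : Measurable k) {f : ℝ → ℂ}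
    (hf : AEStronglyMeasurable f unitMeasure) :
    ∫⁻ x, (∫⁻ y, ‖k (x - y)‖ₑ * ‖f y‖ₑ ∂unitMeasure) ^ (2 : ℝ) ∂unitMeasure
      ≤ (∫⁻ s, ‖k s‖ₑ) ^ (2 : ℝ) * ∫⁻ y, ‖f y‖ₑ ^ (2 : ℝ) ∂unitMeasure := by
  have hfe : AEMeasurable (fun y => ‖f y‖ₑ) unitMeasure := hf.enorm
  have hmass : ∀ x, ∫⁻ y, ‖k (x - y)‖ₑ ∂unitMeasure ≤ ∫⁻ s, ‖k s‖ₑ := fun x =>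
    (lintegral_mono' Measure.restrict_le_self le_rfl).trans
      (lintegral_sub_left_eq_self (fun s => ‖k s‖ₑ) x).le
  have hmass' : ∀ y, ∫⁻ x, ‖k (x - y)‖ₑ ∂unitMeasure ≤ ∫⁻ s, ‖k s‖ₑ := fun y =>
    (lintegral_mono' Measure.restrict_le_self le_rfl).trans
      (lintegral_sub_right_eq_self (fun s => ‖k s‖ₑ) y).le
  have hpt : ∀ x, (∫⁻ y, ‖k (x - y)‖ₑ * ‖f y‖ₑ ∂unitMeasure) ^ (2 : ℝ)
      ≤ (∫⁻ s, ‖k s‖ₑ) * ∫⁻ y, ‖k (x - y)‖ₑ * ‖f y‖ₑ ^ (2 : ℝ) ∂unitMeasure := by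
    intro x
    have hkx : AEMeasurable (fun y => ‖k (x - y)‖ₑ) unitMeasure := by fun_prop
    have h2 : ∀ a : ℝ≥0∞, (a ^ (1 / 2 : ℝ)) ^ (2 : ℝ) = a := fun a => by
      rw [← ENNReal.rpow_mul]; norm_num
    have hsplit : ∀ a : ℝ≥0∞, a ^ (1 / 2 : ℝ) * a ^ (1 / 2 : ℝ) = a := fun a => by
      rw [← ENNReal.rpow_add_of_nonneg _ _ (by norm_num) (by norm_num)]; norm_num
    have hH := ENNReal.lintegral_mul_le_Lp_mul_Lq unitMeasure Real.HolderConjugate.two_two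
      (f := fun y => ‖k (x - y)‖ₑ ^ (1 / 2 : ℝ))
      (g := fun y => ‖k (x - y)‖ₑ ^ (1 / 2 : ℝ) * ‖f y‖ₑ)
      (hkx.pow_const _) ((hkx.pow_const _).mul hfe)
    simp only [Pi.mul_apply, ← mul_assoc, hsplit, h2,
      ENNReal.mul_rpow_of_nonneg _ _ (zero_le_two (α := ℝ))] at hH
    calc _ ≤ _ := ENNReal.rpow_le_rpow hH zero_le_two
      _ = (∫⁻ y, ‖k (x - y)‖ₑ ∂unitMeasure) *
          ∫⁻ y, ‖k (x - y)‖ₑ * ‖f y‖ₑ ^ (2 : ℝ) ∂unitMeasure := by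
        rw [ENNReal.mul_rpow_of_nonneg _ _ zero_le_two, h2, h2]
      _ ≤ _ := mul_le_mul_left (hmass x) _
  have hmeas : AEMeasurable (Function.uncurry fun x y => ‖k (x - y)‖ₑ * ‖f y‖ₑ ^ (2 : ℝ))
      (unitMeasure.prod unitMeasure) := by
    refine AEMeasurable.mul ?_ ?_
    · exact (hk.comp (measurable_fst.sub measurable_snd)).enorm.aemeasurable
    · exact (hfe.pow_const _).comp_snd
  calc _ ≤ ∫⁻ x, (∫⁻ s, ‖k s‖ₑ) *
        ∫⁻ y, ‖k (x - y)‖ₑ * ‖f y‖ₑ ^ (2 : ℝ) ∂unitMeasure ∂unitMeasure := lintegral_mono hpt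
    _ = (∫⁻ s, ‖k s‖ₑ) *
        ∫⁻ x, ∫⁻ y, ‖k (x - y)‖ₑ * ‖f y‖ₑ ^ (2 : ℝ) ∂unitMeasure ∂unitMeasure :=
      lintegral_const_mul'' _ hmeas.lintegral_prod_right'
    _ = (∫⁻ s, ‖k s‖ₑ) *
        ∫⁻ y, (∫⁻ x, ‖k (x - y)‖ₑ ∂unitMeasure) * ‖f y‖ₑ ^ (2 : ℝ) ∂unitMeasure := by
      rw [lintegral_lintegral_swap hmeas]
      congr 1
      refine lintegral_congr fun y => ?_
      exact lintegral_mul_const _ (by fun_prop)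
    _ ≤ (∫⁻ s, ‖k s‖ₑ) * ∫⁻ y, (∫⁻ s, ‖k s‖ₑ) * ‖f y‖ₑ ^ (2 : ℝ) ∂unitMeasure := by
      refine mul_le_mul_right (lintegral_mono fun y => ?_) _
      exact mul_le_mul_left (hmass' y) _
    _ = _ := by
      rw [lintegral_const_mul'' _ (hfe.pow_const _), ← mul_assoc, ENNReal.rpow_two, sq]

theorem ae_integrable {α : ℝ} (hα : 0 < α) {f : ℝ → ℂ} (hf : MemLp f 2 unitMeasure) :
    ∀ᵐ x ∂unitMeasure, Integrable (fun y => ((ker α (x - y) : ℝ) : ℂ) * f y) unitMeasure := by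
  have hS := schur (measurable_ker α) hf.1
  have hfin : (∫⁻ s, ‖ker α s‖ₑ) ^ (2 : ℝ) * ∫⁻ y, ‖f y‖ₑ ^ (2 : ℝ) ∂unitMeasure < ∞ := by
    refine ENNReal.mul_lt_top (ENNReal.rpow_lt_top_of_nonneg zero_le_two
      (integrable_ker hα).2.ne) ?_
    simpa using lintegral_rpow_enorm_lt_top_of_eLpNorm_lt_top two_ne_zero ENNReal.ofNat_ne_top hf.2
  have hm : AEMeasurable (fun x => (∫⁻ y, ‖ker α (x - y)‖ₑ * ‖f y‖ₑ ∂unitMeasure) ^ (2 : ℝ))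
      unitMeasure := by
    refine AEMeasurable.pow_const ?_ _
    have : AEMeasurable (Function.uncurry fun x y => ‖ker α (x - y)‖ₑ * ‖f y‖ₑ)
        (unitMeasure.prod unitMeasure) :=
      ((measurable_ker α).comp (measurable_fst.sub measurable_snd)).enorm.aemeasurable.mul
        hf.1.enorm.comp_snd
    exact this.lintegral_prod_right'
  filter_upwards [ae_lt_top' hm (hS.trans_lt hfin).ne] with x hx
  refine ⟨?_, ?_⟩
  · refine AEStronglyMeasurable.mul ?_ hf.1
    have := measurable_ker α
    exact (by fun_prop : Measurable fun y => ((ker α (x - y) : ℝ) : ℂ)).aestronglyMeasurable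
  · have := (ENNReal.rpow_lt_top_iff_of_pos (zero_lt_two (α := ℝ))).1 hx
    simpa [HasFiniteIntegral, enorm_mul, enorm_ofReal_eq] using this

theorem fracFun_ae (α : ℝ) (f : ℝ → ℂ) :
    fracFun α f =ᵐ[unitMeasure] fun x => ∫ y, ((ker α (x - y) : ℝ) : ℂ) * f y ∂unitMeasure :=
  (ae_restrict_iff' measurableSet_Icc).2 (Eventually.of_forall fun _ hx => fracFun_eq α f hx)

theorem eLpNorm_fracFun_le (α : ℝ) {f : ℝ → ℂ} (hf : AEStronglyMeasurable f unitMeasure) :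
    eLpNorm (fracFun α f) 2 unitMeasure ≤ (∫⁻ s, ‖ker α s‖ₑ) * eLpNorm f 2 unitMeasure := by
  rw [eLpNorm_congr_ae (fracFun_ae α f), eLpNorm_eq_lintegral_rpow_enorm_toReal two_ne_zero
    ENNReal.ofNat_ne_top, eLpNorm_eq_lintegral_rpow_enorm_toReal two_ne_zero ENNReal.ofNat_ne_top]
  simp only [ENNReal.toReal_ofNat]
  have h2 : ∀ a : ℝ≥0∞, (a ^ (2 : ℝ)) ^ (1 / 2 : ℝ) = a := fun a => by
    rw [← ENNReal.rpow_mul]; norm_num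
  calc _ ≤ ((∫⁻ s, ‖ker α s‖ₑ) ^ (2 : ℝ) *
        ∫⁻ y, ‖f y‖ₑ ^ (2 : ℝ) ∂unitMeasure) ^ (1 / 2 : ℝ) := by
        refine ENNReal.rpow_le_rpow ?_ (by norm_num)
        refine le_trans (lintegral_mono fun x => ?_) (schur (measurable_ker α) hf)
        refine ENNReal.rpow_le_rpow ?_ zero_le_two
        refine (enorm_integral_le_lintegral_enorm _).trans (le_of_eq ?_)
        simp [enorm_mul, enorm_ofReal_eq]
    _ = _ := by rw [ENNReal.mul_rpow_of_nonneg _ _ (by norm_num), h2]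

theorem memLp_fracFun {α : ℝ} (hα : 0 < α) {f : ℝ → ℂ} (hf : MemLp f 2 unitMeasure) :
    MemLp (fracFun α f) 2 unitMeasure := by
  refine ⟨?_, (eLpNorm_fracFun_le α hf.1).trans_lt
    (ENNReal.mul_lt_top (integrable_ker hα).2 hf.2)⟩
  refine AEStronglyMeasurable.congr ?_ (fracFun_ae α f).symm
  refine AEStronglyMeasurable.integral_prod_right'
    (f := fun p : ℝ × ℝ => ((ker α (p.1 - p.2) : ℝ) : ℂ) * f p.2) ?_
  refine AEStronglyMeasurable.mul ?_ hf.1.comp_snd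
  have := measurable_ker α
  exact (by fun_prop : Measurable fun p : ℝ × ℝ =>
    ((ker α (p.1 - p.2) : ℝ) : ℂ)).aestronglyMeasurable

/-- The modified fractional Volterra operator `L^α`, `α > 0`, as a linear map of `L²([0,1])`. -/
def fracLin (α : ℝ) (hα : 0 < α) : L2 →ₗ[ℂ] L2 where
  toFun f := (memLp_fracFun hα (Lp.memLp f)).toLp (fracFun α f)
  map_add' f g := by
    rw [← MemLp.toLp_add, MemLp.toLp_eq_toLp_iff]
    filter_upwards [fracFun_ae α (f + g : L2), fracFun_ae α f, fracFun_ae α g,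
      ae_integrable hα (Lp.memLp f), ae_integrable hα (Lp.memLp g)] with x h h1 h2 i1 i2
    rw [Pi.add_apply, h, h1, h2, ← integral_add i1 i2]
    refine integral_congr_ae ?_
    filter_upwards [Lp.coeFn_add f g] with y hy
    rw [hy, Pi.add_apply, mul_add]
  map_smul' c f := by
    rw [RingHom.id_apply, ← MemLp.toLp_const_smul, MemLp.toLp_eq_toLp_iff]
    filter_upwards [fracFun_ae α (c • f : L2), fracFun_ae α f] with x h h1
    rw [Pi.smul_apply, h, h1, smul_eq_mul, ← integral_const_mul]
    refine integral_congr_ae ?_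
    filter_upwards [Lp.coeFn_smul c f] with y hy
    rw [hy, Pi.smul_apply, smul_eq_mul]
    ring

/-- The modified fractional Volterra operator `L^α` as a bounded operator on `L²([0,1])`
(only `α > 0` is meaningful; the value is `0` otherwise). -/
def frac (α : ℝ) : L2 →L[ℂ] L2 :=
  if hα : 0 < α then
    (fracLin α hα).mkContinuous (∫⁻ s, ‖ker α s‖ₑ).toReal fun f => by
      change ‖(memLp_fracFun hα (Lp.memLp f)).toLp (fracFun α f)‖ ≤ _
      rw [Lp.norm_toLp, Lp.norm_def, ← ENNReal.toReal_mul]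
      exact ENNReal.toReal_mono
        (ENNReal.mul_lt_top (integrable_ker hα).2 (Lp.memLp f).2).ne
        (eLpNorm_fracFun_le α (Lp.memLp f).1)
  else 0

theorem frac_ae {α : ℝ} (hα : 0 < α) (f : L2) : frac α f =ᵐ[unitMeasure] fracFun α f := by
  rw [frac, dif_pos hα]
  exact MemLp.coeFn_toLp (memLp_fracFun hα (Lp.memLp f))

/-- `A = -∫_0^{1/2} L^α dα`, a Bochner integral in the space of bounded operators. -/
def opA : L2 →L[ℂ] L2 := -∫ α in (0 : ℝ)..(1 / 2), frac α

/-- `T = e^A`. -/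
def opT : L2 →L[ℂ] L2 := NormedSpace.exp opA

end ModVolterra

end

namespace ModVolterra

/-! Each `L^α` is a causal convolution whose kernel, weighted by `e ^ (-ls)` with `l ≥ 0`, has
Fourier transform `w ^ (-α)` on the line `Re w = 1 + l` (`fourier_weightedKer`). Weights `e ^ (±lx)`
on `[0,1]` cost at most a factor `e ^ l`, so Plancherel bounds the operator norm by `e ^ l` times
the sup of the symbol. By the semigroup law the span of the identity and the `L^α` is already an
algebra, so this bound holds on its closure (`norm_fst_le_of_mem`), which contains `A` and `T` with
symbols `-s(w)` and `e ^ (-s(w))`, where `s(w) = ∫_0^{1/2} w ^ (-α) dα` is `symbol`.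

The parameter `l` plays two roles. With `l = 0` nothing is lost, and the growth estimates reduce to
bounding `t |s| e ^ (-t Re s)`. For `|w|` large, `s` is almost real and positive, so `x e ^ (-x) ≤
1/e` nearly gives the bound; for `|w|` bounded, `Re s` is bounded below and the quantity decays
exponentially (`eventually_mul_norm_symbol_le`). With `l → ∞` the symbol tends uniformly to `0` like
`1 / log l`, while `e ^ l` does not depend on the power taken, so `A` and `T - 1` are quasinilpotent
(`exists_norm_pow_le`).

Positivity of the kernels gives `A ≠ 0`, and the growth bound then excludes `T = 1`. Sharpness
follows from `liminf ≤ limsup ≤ 1/e < C`. -/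

open Complex in
theorem norm_exp_sub_one_le_of_re_nonpos {z : ℂ} (hz : z.re ≤ 0) : ‖exp z - 1‖ ≤ ‖z‖ := by
  have hconv : Convex ℝ {z : ℂ | z.re ≤ 0} := convex_halfSpace_re_le 0
  have := hconv.norm_image_sub_le_of_norm_deriv_le (f := exp) (C := 1) (x := 0) (y := z)
    (fun x _ => differentiableAt_exp) (fun x hx => by
      rw [Complex.deriv_exp, norm_exp]
      exact Real.exp_le_one_iff.2 hx) (by simp) hz
  simpa using this

/-! ### Laplace transform of the kernel -/

/-- The Laplace transform of `s ↦ s ^ (α - 1)` on the right half-plane. -/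
theorem integral_rpow_mul_cexp_neg_mul {α : ℝ} (hα : 0 < α) {w : ℂ} (hw : 0 < w.re) :
    ∫ s in Set.Ioi (0 : ℝ), ((s ^ (α - 1) : ℝ) : ℂ) * Complex.exp (-(w * s))
      = w ^ (-(α : ℂ)) * Real.Gamma α := by
  set U : Set ℂ := {w | 0 < w.re} with hU
  have hUo : IsOpen U := isOpen_lt continuous_const Complex.continuous_re
  have hint : ∀ r : ℝ, 0 < r →
      IntegrableOn (fun s : ℝ => s ^ (α - 1) * Real.exp (-r * s)) (Set.Ioi 0) := fun r hr => by
    simpa using integrableOn_rpow_mul_exp_neg_mul_rpow (p := 1) (s := α - 1) (by linarith)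
      one_pos hr
  have hint' : ∀ r : ℝ, 0 < r →
      IntegrableOn (fun s : ℝ => s ^ α * Real.exp (-r * s)) (Set.Ioi 0) := fun r hr => by
    simpa using integrableOn_rpow_mul_exp_neg_mul_rpow (p := 1) (s := α) (by linarith)
      one_pos hr
  have hdiff : DifferentiableOn ℂ (fun w : ℂ =>
      ∫ s in Set.Ioi (0 : ℝ), ((s ^ (α - 1) : ℝ) : ℂ) * Complex.exp (-(w * s))) U := by
    intro v hv
    have hv2 : 0 < v.re / 2 := half_pos hv
    have key := hasDerivAt_integral_of_dominated_loc_of_deriv_le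
      (μ := volume.restrict (Set.Ioi (0 : ℝ)))
      (F := fun (w : ℂ) (s : ℝ) => ((s ^ (α - 1) : ℝ) : ℂ) * Complex.exp (-(w * s)))
      (F' := fun (w : ℂ) (s : ℝ) => ((s ^ (α - 1) : ℝ) : ℂ) * (Complex.exp (-(w * s)) * (-s)))
      (x₀ := v) (s := {w : ℂ | v.re / 2 < w.re})
      -- Differentiating in `w` brings down a factor `s`; on `Re w > Re v / 2` the result is
      -- dominated by this integrable function.
      (bound := fun s => s ^ α * Real.exp (-(v.re / 2) * s))
      ((isOpen_lt continuous_const Complex.continuous_re).mem_nhds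
        (by change v.re / 2 < v.re; linarith [show 0 < v.re from hv]))
      (Eventually.of_forall fun w => by
        apply Measurable.aestronglyMeasurable
        fun_prop) ?_ (by
        apply Measurable.aestronglyMeasurable
        fun_prop) ?_ (hint' _ hv2) ?_
    · exact key.2.differentiableAt.differentiableWithinAt
    · refine (hint _ hv).mono' (by
        apply Measurable.aestronglyMeasurable
        fun_prop) ?_
      refine (ae_restrict_iff' measurableSet_Ioi).2 (Eventually.of_forall fun s hs => ?_)
      have hs' : 0 ≤ s ^ (α - 1) := Real.rpow_nonneg (le_of_lt hs) _
      rw [norm_mul, Complex.norm_real, Real.norm_of_nonneg hs', Complex.norm_exp]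
      simp
    · refine (ae_restrict_iff' measurableSet_Ioi).2 (Eventually.of_forall fun s hs w hw => ?_)
      have hs0 : 0 < s := hs
      have hs' : 0 ≤ s ^ (α - 1) := Real.rpow_nonneg hs0.le _
      have hsα : s ^ α = s ^ (α - 1) * s := by
        rw [← Real.rpow_add_one hs0.ne']; simp
      rw [norm_mul, norm_mul, Complex.norm_real, Real.norm_of_nonneg hs', Complex.norm_exp,
        norm_neg, Complex.norm_real, Real.norm_of_nonneg hs0.le, hsα,
        show s ^ (α - 1) * (Real.exp (-(w * s)).re * s)
          = s ^ (α - 1) * s * Real.exp (-(w * s)).re by ring]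
      refine mul_le_mul_of_nonneg_left (Real.exp_le_exp.2 ?_) (by positivity)
      have : v.re / 2 * s ≤ w.re * s := mul_le_mul_of_nonneg_right (le_of_lt hw) hs0.le
      simpa using this
    · refine Eventually.of_forall fun s w _ => ?_
      refine HasDerivAt.const_mul _ ?_
      exact (hasDerivAt_mul_const (s : ℂ)).neg.cexp
  have hdiff2 : DifferentiableOn ℂ (fun w : ℂ => w ^ (-(α : ℂ)) * Real.Gamma α) U := by
    intro v hv
    refine (DifferentiableAt.mul_const ?_ _).differentiableWithinAt
    exact differentiableAt_id.cpow (differentiableAt_const _) (Or.inl hv)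
  have hpre : IsPreconnected U := (convex_halfSpace_re_gt 0).isPreconnected
  have h1 : (1 : ℂ) ∈ U := by simp [hU]
  -- Identity theorem: the real Gamma integral gives equality on the positive axis, in particular at
  -- the points `1 + 1/(n+1)` accumulating at `1`.
  refine (hdiff.analyticOnNhd hUo).eqOn_of_preconnected_of_frequently_eq
    (hdiff2.analyticOnNhd hUo) hpre h1 ?_ hw
  have hreal : ∀ r : ℝ, 0 < r →
      ∫ s in Set.Ioi (0 : ℝ), ((s ^ (α - 1) : ℝ) : ℂ) * Complex.exp (-((r : ℂ) * s))
        = (r : ℂ) ^ (-(α : ℂ)) * Real.Gamma α := fun r hr => by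
    have := congrArg (fun x : ℝ => (x : ℂ)) (Real.integral_rpow_mul_exp_neg_mul_Ioi hα hr)
    simp only [← integral_complex_ofReal] at this
    push_cast at this
    rw [this, ← Complex.ofReal_neg, ← Complex.ofReal_cpow hr.le, one_div,
      Real.inv_rpow hr.le, Real.rpow_neg hr.le]
  have hseq : Tendsto (fun n : ℕ => (((1 : ℝ) + 1 / ((n : ℝ) + 1) : ℝ) : ℂ)) atTop (𝓝[≠] 1) := by
    refine tendsto_nhdsWithin_iff.2 ⟨?_, Eventually.of_forall fun n => ?_⟩
    · have := (tendsto_one_div_add_atTop_nhds_zero_nat (𝕜 := ℝ)).const_add 1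
      rw [add_zero] at this
      have h2 := (Complex.continuous_ofReal.tendsto 1).comp this
      simpa [Function.comp_def] using h2
    · have h : (1 : ℝ) / ((n : ℝ) + 1) ≠ 0 := by positivity
      rw [Set.mem_compl_iff, Set.mem_singleton_iff]
      intro hh
      apply h
      have : ((1 : ℝ) + 1 / ((n : ℝ) + 1)) = 1 := by exact_mod_cast hh
      linarith
  exact hseq.frequently (Eventually.of_forall fun n => hreal _ (by positivity)).frequently

/-! ### The symbol: size, sector and dependence on the exponent -/

/-- The symbol `∫_0^{1/2} w ^ (-α) dα`. -/
noncomputable def symbol (w : ℂ) : ℂ := ∫ α in (0 : ℝ)..(1 / 2), w ^ (-(α : ℂ))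

theorem norm_cpow_neg {w : ℂ} (hw : 0 < w.re) (α : ℝ) :
    ‖w ^ (-(α : ℂ))‖ = Real.exp (-(α * Real.log ‖w‖)) := by
  have h0 : 0 < ‖w‖ := norm_pos_iff.2 fun h => by simp [h] at hw
  rw [← Complex.ofReal_neg, Complex.norm_cpow_real, Real.rpow_def_of_pos h0]
  congr 1; ring

theorem cpow_neg_re_im {w : ℂ} (hw : 0 < w.re) (α : ℝ) :
    (w ^ (-(α : ℂ))).re = Real.exp (-(α * Real.log ‖w‖)) * Real.cos (α * w.arg) ∧
    (w ^ (-(α : ℂ))).im = -(Real.exp (-(α * Real.log ‖w‖)) * Real.sin (α * w.arg)) := by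
  have h0 : w ≠ 0 := fun h => by simp [h] at hw
  rw [Complex.cpow_def_of_ne_zero h0]
  constructor
  · rw [Complex.exp_re]
    simp [Complex.log_re, Complex.log_im, mul_comm]
  · rw [Complex.exp_im]
    simp [Complex.log_re, Complex.log_im, mul_comm]

theorem continuous_cpow_neg {w : ℂ} (hw : 0 < w.re) :
    Continuous fun α : ℝ => w ^ (-(α : ℂ)) := by
  have h0 : w ≠ 0 := fun h => by simp [h] at hw
  exact (Complex.continuous_ofReal.neg).const_cpow (Or.inl h0)

/-- `∫_0^{1/2} e ^ (-αL) dα`. -/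
noncomputable def expMean (L : ℝ) : ℝ := ∫ α in (0 : ℝ)..(1 / 2), Real.exp (-(α * L))

/-- The left side is `1 - e ^ (-L/2)`. This is the logarithmic decay of the symbol behind
quasinilpotency. -/
theorem expMean_mul_le (L : ℝ) : L * expMean L ≤ 1 := by
  have h : ∫ α in (0 : ℝ)..(1 / 2), L * Real.exp (-(α * L))
      = -Real.exp (-(1 / 2 * L)) - -Real.exp (-(0 * L)) := by
    refine intervalIntegral.integral_eq_sub_of_hasDerivAt
      (f := fun α => -Real.exp (-(α * L))) (fun α _ => ?_)
      (Continuous.intervalIntegrable (by fun_prop) _ _)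
    have h1 : HasDerivAt (fun α : ℝ => -(α * L)) (-L) α := (hasDerivAt_mul_const L).neg
    refine h1.exp.neg.congr_deriv ?_
    ring
  rw [expMean, ← intervalIntegral.integral_const_mul, h]
  have := Real.exp_pos (-(1 / 2 * L))
  simp only [zero_mul, neg_zero, Real.exp_zero]
  linarith

/-- Integration by parts, with a boundary term of the favourable sign. The first moment bounds the
imaginary part of the symbol, so this makes it smaller than the real part by a factor of order
`1/L`. -/
theorem mul_integral_mul_exp_le (L : ℝ) :
    L * ∫ α in (0 : ℝ)..(1 / 2), α * Real.exp (-(α * L)) ≤ expMean L := by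
  have h : ∫ α in (0 : ℝ)..(1 / 2), (Real.exp (-(α * L)) - L * (α * Real.exp (-(α * L))))
      = 1 / 2 * Real.exp (-(1 / 2 * L)) - 0 * Real.exp (-(0 * L)) := by
    refine intervalIntegral.integral_eq_sub_of_hasDerivAt
      (f := fun α => α * Real.exp (-(α * L))) (fun α _ => ?_)
      (Continuous.intervalIntegrable (by fun_prop) _ _)
    have h1 : HasDerivAt (fun α : ℝ => -(α * L)) (-L) α := (hasDerivAt_mul_const L).neg
    refine ((hasDerivAt_id α).mul h1.exp).congr_deriv ?_
    simp only [id]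
    ring
  rw [intervalIntegral.integral_sub (Continuous.intervalIntegrable (by fun_prop) _ _)
    (Continuous.intervalIntegrable (by fun_prop) _ _), intervalIntegral.integral_const_mul] at h
  have := Real.exp_pos (-(1 / 2 * L))
  rw [expMean]
  linarith

theorem expMean_ge {L : ℝ} (hL : 0 ≤ L) : Real.exp (-L) / 2 ≤ expMean L := by
  have : ∫ _ in (0 : ℝ)..(1 / 2), Real.exp (-L) ≤ expMean L := by
    refine intervalIntegral.integral_mono_on (by norm_num) (by simp)
      (Continuous.intervalIntegrable (by fun_prop) _ _) fun α hα => ?_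
    refine Real.exp_le_exp.2 (neg_le_neg ?_)
    nlinarith [hα.1, hα.2]
  simp at this
  linarith

theorem norm_symbol_le {w : ℂ} (hw : 0 < w.re) : ‖symbol w‖ ≤ expMean (Real.log ‖w‖) := by
  refine (intervalIntegral.norm_integral_le_integral_norm (by norm_num)).trans (le_of_eq ?_)
  simp_rw [norm_cpow_neg hw]
  rfl

theorem symbol_re {w : ℂ} (hw : 0 < w.re) :
    (symbol w).re = ∫ α in (0 : ℝ)..(1 / 2), (w ^ (-(α : ℂ))).re :=
  (Complex.reCLM.intervalIntegral_comp_comm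
    ((continuous_cpow_neg hw).intervalIntegrable _ _)).symm

theorem symbol_im {w : ℂ} (hw : 0 < w.re) :
    (symbol w).im = ∫ α in (0 : ℝ)..(1 / 2), (w ^ (-(α : ℂ))).im :=
  (Complex.imCLM.intervalIntegral_comp_comm
    ((continuous_cpow_neg hw).intervalIntegrable _ _)).symm

theorem abs_mul_arg_le {w : ℂ} (hw : 0 < w.re) {α : ℝ} (hα : 0 ≤ α) :
    |α * w.arg| ≤ 2 * α := by
  have h1 : |w.arg| ≤ Real.pi / 2 := Complex.abs_arg_le_pi_div_two_iff.2 hw.le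
  rw [abs_mul, abs_of_nonneg hα, mul_comm]
  exact mul_le_mul_of_nonneg_right (h1.trans (by linarith [Real.pi_le_four])) hα

/-- For `α ≤ 1/2` and `|arg w| ≤ π/2 ≤ 2` the angle `α arg w` is at most `1` in modulus, where `cos
≥ 1/2`. -/
theorem symbol_re_ge {w : ℂ} (hw : 0 < w.re) :
    expMean (Real.log ‖w‖) / 2 ≤ (symbol w).re := by
  rw [symbol_re hw, expMean, div_eq_mul_inv, ← intervalIntegral.integral_mul_const]
  refine intervalIntegral.integral_mono_on (by norm_num)
    (Continuous.intervalIntegrable (by fun_prop) _ _)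
    ((Complex.continuous_re.comp (continuous_cpow_neg hw)).intervalIntegrable _ _) fun α hα => ?_
  rw [(cpow_neg_re_im hw α).1]
  refine mul_le_mul_of_nonneg_left ?_ (Real.exp_pos _).le
  have h1 := abs_mul_arg_le hw hα.1
  have h2 : |α * w.arg| ≤ 1 := h1.trans (by linarith [hα.2])
  have h3 : (α * w.arg) ^ 2 ≤ 1 := by
    rw [← sq_abs]; exact pow_le_one₀ (abs_nonneg _) h2
  linarith [Real.one_sub_sq_div_two_le_cos (x := α * w.arg)]

/-- `|sin (α arg w)| ≤ 2α` supplies the extra factor `α` that makes the symbol nearly real. -/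
theorem abs_symbol_im_le {w : ℂ} (hw : 0 < w.re) :
    |(symbol w).im| ≤ 2 * ∫ α in (0 : ℝ)..(1 / 2), α * Real.exp (-(α * Real.log ‖w‖)) := by
  rw [symbol_im hw, ← intervalIntegral.integral_const_mul]
  refine (intervalIntegral.abs_integral_le_integral_abs (by norm_num)).trans ?_
  refine intervalIntegral.integral_mono_on (by norm_num)
    ((Complex.continuous_im.comp (continuous_cpow_neg hw)).abs.intervalIntegrable _ _)
    (Continuous.intervalIntegrable (by fun_prop) _ _) fun α hα => ?_
  rw [(cpow_neg_re_im hw α).2, abs_neg, abs_mul, abs_of_pos (Real.exp_pos _), ← mul_assoc,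
    mul_comm]
  refine mul_le_mul_of_nonneg_right ?_ (Real.exp_pos _).le
  exact Real.abs_sin_le_abs.trans (abs_mul_arg_le hw hα.1)

theorem log_norm_nonneg {w : ℂ} (hw : 1 ≤ w.re) : 0 ≤ Real.log ‖w‖ :=
  Real.log_nonneg (hw.trans ((le_abs_self _).trans (Complex.abs_re_le_norm w)))

theorem expMean_pos (L : ℝ) : 0 < expMean L :=
  intervalIntegral.intervalIntegral_pos_of_pos (Continuous.intervalIntegrable (by fun_prop) _ _)
    (fun _ => Real.exp_pos _) (by norm_num)

theorem symbol_re_pos {w : ℂ} (hw : 0 < w.re) : 0 < (symbol w).re :=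
  (half_pos (expMean_pos _)).trans_le (symbol_re_ge hw)

theorem expMean_le {L : ℝ} (hL : 0 ≤ L) : expMean L ≤ 1 / 2 := by
  have : expMean L ≤ ∫ _ in (0 : ℝ)..(1 / 2), (1 : ℝ) := by
    refine intervalIntegral.integral_mono_on (by norm_num)
      (Continuous.intervalIntegrable (by fun_prop) _ _) (by simp) fun α hα => ?_
    exact Real.exp_le_one_iff.2 (neg_nonpos.2 (mul_nonneg hα.1 hL))
  simpa using this

theorem mul_exp_neg_le (x : ℝ) : x * Real.exp (-x) ≤ 1 / Real.exp 1 := by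
  have h := Real.add_one_le_exp (x - 1)
  calc x * Real.exp (-x) ≤ Real.exp (x - 1) * Real.exp (-x) :=
        mul_le_mul_of_nonneg_right (by linarith) (Real.exp_pos _).le
    _ = 1 / Real.exp 1 := by
      rw [← Real.exp_add, one_div, ← Real.exp_neg]; congr 1; ring

/-- Since `symbol w` is nearly real where it is small, `t |symbol| e ^ (-t Re symbol)` is
asymptotically bounded by `1 / e`, uniformly on `Re w ≥ 1`. -/
theorem eventually_mul_norm_symbol_le {ε : ℝ} (hε : 0 < ε) :
    ∀ᶠ t : ℝ in atTop, ∀ w : ℂ, 1 ≤ w.re →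
      t * (‖symbol w‖ * Real.exp (-(t * (symbol w).re))) ≤ 1 / Real.exp 1 + ε := by
  -- `K` separates the regimes. For `L ≥ K`, `|Im s| ≤ 2 expMean / K = ε expMean / 2 ≤ ε Re s`. For
  -- `L ≤ K`, `Re s ≥ expMean / 2 ≥ e ^ (-K) / 4`, which is `c` below.
  set K : ℝ := 4 / ε with hK
  have hKpos : 0 < K := by positivity
  set c : ℝ := Real.exp (-K) / 4 with hc
  have hcpos : 0 < c := by positivity
  have hlim : Tendsto (fun t : ℝ => t * Real.exp (-(c * t))) atTop (𝓝 0) := by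
    have := Real.tendsto_pow_mul_exp_neg_atTop_nhds_zero 1
    have h2 := (this.comp (tendsto_id.const_mul_atTop hcpos)).const_mul c⁻¹
    simp only [mul_zero] at h2
    refine h2.congr fun t => ?_
    simp only [Function.comp, id, pow_one]
    field_simp
  filter_upwards [hlim.eventually (gt_mem_nhds hε), eventually_ge_atTop 0] with t ht ht0 w hw
  have hw0 : 0 < w.re := by linarith
  have hL := log_norm_nonneg hw
  set L := Real.log ‖w‖
  have hre := symbol_re_ge hw0
  have hexp := Real.exp_pos (-(t * (symbol w).re))
  have he1 : 0 < 1 / Real.exp 1 := by positivity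
  have he2 : 1 / Real.exp 1 ≤ 1 := by
    rw [div_le_one (Real.exp_pos 1)]; exact Real.one_le_exp zero_le_one
  rcases le_total L K with hLK | hLK
  · have h1 : c ≤ (symbol w).re := by
      have h2 := expMean_ge hL
      have h3 : Real.exp (-K) ≤ Real.exp (-L) := Real.exp_le_exp.2 (neg_le_neg hLK)
      rw [hc]; linarith
    have h2 : ‖symbol w‖ ≤ 1 := (norm_symbol_le hw0).trans ((expMean_le hL).trans (by norm_num))
    have h3 : Real.exp (-(t * (symbol w).re)) ≤ Real.exp (-(c * t)) :=
      Real.exp_le_exp.2 (neg_le_neg (by nlinarith))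
    calc t * (‖symbol w‖ * Real.exp (-(t * (symbol w).re)))
        ≤ t * (1 * Real.exp (-(c * t))) := by gcongr
      _ ≤ 1 / Real.exp 1 + ε := by rw [one_mul]; linarith
  · have hLpos : 0 < L := hKpos.trans_le hLK
    have h1 : |(symbol w).im| ≤ ε * (symbol w).re := by
      have h2 := abs_symbol_im_le hw0
      have h3 := mul_integral_mul_exp_le L
      have h4 := expMean_pos L
      set M := ∫ α in (0 : ℝ)..(1 / 2), α * Real.exp (-(α * L))
      have h5 : M ≤ expMean L / K := by
        rw [le_div_iff₀ hKpos]
        have hM : 0 ≤ M := intervalIntegral.integral_nonneg (by norm_num) fun α hα =>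
          mul_nonneg hα.1 (Real.exp_pos _).le
        nlinarith
      have h6 : expMean L / K = ε * expMean L / 4 := by rw [hK]; field_simp
      nlinarith
    have h2 : ‖symbol w‖ ≤ (1 + ε) * (symbol w).re := by
      refine (Complex.norm_le_abs_re_add_abs_im _).trans ?_
      rw [abs_of_pos (symbol_re_pos hw0)]; linarith
    calc t * (‖symbol w‖ * Real.exp (-(t * (symbol w).re)))
        ≤ t * ((1 + ε) * (symbol w).re * Real.exp (-(t * (symbol w).re))) := by gcongr
      _ = (1 + ε) * (t * (symbol w).re * Real.exp (-(t * (symbol w).re))) := by ring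
      _ ≤ (1 + ε) * (1 / Real.exp 1) :=
        mul_le_mul_of_nonneg_left (mul_exp_neg_le _) (by positivity)
      _ ≤ 1 / Real.exp 1 + ε := by nlinarith

/-- The derivative in the exponent carries an unbounded `log w`, absorbed by `|w| ^ (-δ)` through `L
e ^ (-δL) ≤ 1/δ`; the `4` bounds `|arg w| ≤ π`. Uniformity in `w` is what yields norm continuity of
`α ↦ L^α` on `(0,∞)`. -/
theorem norm_cpow_neg_sub_le {w : ℂ} (hw : 1 ≤ w.re) {δ α β : ℝ} (hδ : 0 < δ) (hα : δ ≤ α)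
    (hβ : δ ≤ β) :
    ‖w ^ (-(α : ℂ)) - w ^ (-(β : ℂ))‖ ≤ (1 / δ + 4) * |α - β| := by
  wlog h : α ≤ β generalizing α β
  · rw [norm_sub_rev, abs_sub_comm]
    exact this hβ hα (le_of_not_ge h)
  have hw0 : 0 < w.re := by linarith
  have hne : w ≠ 0 := fun h => by simp [h] at hw0
  have hL := log_norm_nonneg hw
  have e1 : w ^ (-(β : ℂ)) = w ^ (-(α : ℂ)) * Complex.exp (-((β - α : ℝ) * Complex.log w)) := by
    rw [Complex.cpow_def_of_ne_zero hne, Complex.cpow_def_of_ne_zero hne, ← Complex.exp_add]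
    congr 1; push_cast; ring
  have e2 : w ^ (-(α : ℂ)) - w ^ (-(β : ℂ)) =
      -(w ^ (-(α : ℂ)) * (Complex.exp (-((β - α : ℝ) * Complex.log w)) - 1)) := by
    rw [e1]; ring
  have h3 : ‖Complex.exp (-((β - α : ℝ) * Complex.log w)) - 1‖
      ≤ (β - α) * (Real.log ‖w‖ + 4) := by
    refine (norm_exp_sub_one_le_of_re_nonpos ?_).trans ?_
    · rw [Complex.neg_re, Complex.re_ofReal_mul, Complex.log_re]
      exact neg_nonpos.2 (mul_nonneg (by linarith) hL)
    · rw [norm_neg, norm_mul, Complex.norm_real, Real.norm_of_nonneg (by linarith)]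
      refine mul_le_mul_of_nonneg_left ?_ (by linarith)
      refine (Complex.norm_le_abs_re_add_abs_im _).trans ?_
      rw [Complex.log_re, Complex.log_im, abs_of_nonneg hL]
      linarith [Complex.abs_arg_le_pi w, Real.pi_le_four]
  rw [e2, norm_neg, norm_mul, norm_cpow_neg hw0, abs_sub_comm, abs_of_nonneg (by linarith)]
  set L := Real.log ‖w‖
  have h4 : Real.exp (-(α * L)) * (L + 4) ≤ 1 / δ + 4 := by
    have h5 : Real.exp (-(α * L)) ≤ Real.exp (-(δ * L)) :=
      Real.exp_le_exp.2 (neg_le_neg (mul_le_mul_of_nonneg_right hα hL))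
    have h6 : Real.exp (-(δ * L)) ≤ 1 := Real.exp_le_one_iff.2 (neg_nonpos.2 (by positivity))
    have h7 : Real.exp (-(δ * L)) * L ≤ 1 / δ := by
      rw [le_div_iff₀ hδ, Real.exp_neg]
      have := Real.add_one_le_exp (δ * L)
      rw [mul_assoc, inv_mul_le_iff₀ (Real.exp_pos _)]
      linarith
    calc Real.exp (-(α * L)) * (L + 4) ≤ Real.exp (-(δ * L)) * (L + 4) := by gcongr
      _ ≤ 1 / δ + 4 := by nlinarith
  calc Real.exp (-(α * L)) * ‖Complex.exp (-((β - α : ℝ) * Complex.log w)) - 1‖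
      ≤ Real.exp (-(α * L)) * ((β - α) * (L + 4)) := by gcongr
    _ = Real.exp (-(α * L)) * (L + 4) * (β - α) := by ring
    _ ≤ (1 / δ + 4) * (β - α) := mul_le_mul_of_nonneg_right h4 (by linarith)

/-! ### The semigroup law -/

theorem ker_nonneg {α : ℝ} (hα : 0 < α) (s : ℝ) : 0 ≤ ker α s := by
  unfold ker
  split_ifs with hs
  · have := Real.Gamma_pos_of_pos hα
    positivity
  · exact le_rfl

theorem ker_pos {α : ℝ} (hα : 0 < α) {s : ℝ} (hs : 0 < s) : 0 < ker α s := by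
  have := Real.Gamma_pos_of_pos hα
  rw [ker, if_pos hs]
  positivity

theorem integral_rpow_mul_sub_rpow {α β a : ℝ} (hα : 0 < α) (hβ : 0 < β) (ha : 0 < a) :
    ∫ u in (0 : ℝ)..a, u ^ (β - 1) * (a - u) ^ (α - 1)
      = a ^ (α + β - 1) * (Real.Gamma α * Real.Gamma β / Real.Gamma (α + β)) := by
  have h := Complex.betaIntegral_scaled (β : ℂ) (α : ℂ) ha
  have hG := Complex.Gamma_mul_Gamma_eq_betaIntegral (s := (β : ℂ)) (t := (α : ℂ))
    (by simpa using hβ) (by simpa using hα)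
  have hGne : Complex.Gamma ((α + β : ℝ) : ℂ) ≠ 0 := by
    rw [Complex.Gamma_ofReal]
    exact_mod_cast (Real.Gamma_pos_of_pos (add_pos hα hβ)).ne'
  have h2 : ((∫ u in (0 : ℝ)..a, u ^ (β - 1) * (a - u) ^ (α - 1) : ℝ) : ℂ)
      = ∫ x in (0 : ℝ)..a, (x : ℂ) ^ ((β : ℂ) - 1) * ((a : ℂ) - x) ^ ((α : ℂ) - 1) := by
    rw [← intervalIntegral.integral_ofReal]
    refine intervalIntegral.integral_congr fun u hu => ?_
    rw [Set.uIcc_of_le ha.le] at hu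
    push_cast [Complex.ofReal_cpow hu.1, Complex.ofReal_cpow (sub_nonneg.2 hu.2)]
    rfl
  apply Complex.ofReal_injective
  rw [h2, h]
  have hB : Complex.betaIntegral β α
      = ((Real.Gamma α * Real.Gamma β / Real.Gamma (α + β) : ℝ) : ℂ) := by
    push_cast
    rw [← Complex.Gamma_ofReal, ← Complex.Gamma_ofReal, ← Complex.Gamma_ofReal, eq_div_iff hGne,
      mul_comm (Complex.Gamma α), hG]
    push_cast
    rw [add_comm (α : ℂ), mul_comm]
  rw [hB]
  push_cast [Complex.ofReal_cpow ha.le]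
  rw [add_comm (α : ℂ)]

/-- The exponentials combine to `e ^ (-(x - z))`, and what remains is a Beta integral over `[z,x]`,
an interval inside `[0,1]`. -/
theorem integral_ker_mul_ker {α β : ℝ} (hα : 0 < α) (hβ : 0 < β) {x z : ℝ}
    (hx : x ∈ Set.Icc (0 : ℝ) 1) (hz : z ∈ Set.Icc (0 : ℝ) 1) :
    ∫ y, ker α (x - y) * ker β (y - z) ∂unitMeasure = ker (α + β) (x - z) := by
  rcases le_or_gt x z with h | h
  · have h0 : ∀ y, ker α (x - y) * ker β (y - z) = 0 := fun y => by
      rcases le_or_gt x y with h1 | h1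
      · simp [ker, not_lt.2 (sub_nonpos.2 h1)]
      · have : ¬ z < y := by linarith
        simp [ker, this]
    simp only [h0, integral_zero]
    simp [ker, not_lt.2 h]
  · have hΓ := (Real.Gamma_pos_of_pos hα).ne'
    have hΓ' := (Real.Gamma_pos_of_pos hβ).ne'
    have ha : 0 < x - z := sub_pos.2 h
    set c : ℝ := (Real.Gamma α)⁻¹ * (Real.Gamma β)⁻¹ * Real.exp (-(x - z)) with hc
    have e1 : ∫ y, ker α (x - y) * ker β (y - z) ∂unitMeasure
        = ∫ y in z..x, c * ((y - z) ^ (β - 1) * (x - z - (y - z)) ^ (α - 1)) := by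
      rw [intervalIntegral.integral_of_le h.le, integral_Ioc_eq_integral_Ioo,
        ← integral_indicator measurableSet_Ioo, unitMeasure,
        ← integral_indicator measurableSet_Icc]
      congr 1
      ext y
      by_cases h1 : z < y
      · by_cases h2 : y < x
        · have h3 : y ∈ Set.Icc (0 : ℝ) 1 := ⟨hz.1.trans h1.le, h2.le.trans hx.2⟩
          have hE : Real.exp (-(x - z)) = Real.exp (-(x - y)) * Real.exp (-(y - z)) := by
            rw [← Real.exp_add]; congr 1; ring
          rw [Set.indicator_of_mem h3, Set.indicator_of_mem (Set.mem_Ioo.2 ⟨h1, h2⟩), ker, ker,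
            if_pos (sub_pos.2 h2), if_pos (sub_pos.2 h1), hc, hE, sub_sub_sub_cancel_right]
          ring
        · simp [Set.indicator, h2, ker]
      · simp [Set.indicator, h1, ker]
    rw [e1, intervalIntegral.integral_comp_sub_right
      (fun u => c * (u ^ (β - 1) * (x - z - u) ^ (α - 1))) z, sub_self,
      intervalIntegral.integral_const_mul, integral_rpow_mul_sub_rpow hα hβ ha, ker, if_pos ha, hc]
    field_simp

theorem integrable_ker_mul_ker {α β : ℝ} (hα : 0 < α) (hβ : 0 < β) {x z : ℝ}
    (hx : x ∈ Set.Icc (0 : ℝ) 1) (hz : z ∈ Set.Icc (0 : ℝ) 1) :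
    Integrable (fun y => ker α (x - y) * ker β (y - z)) unitMeasure := by
  rcases le_or_gt x z with h | h
  · have h0 : ∀ y, ker α (x - y) * ker β (y - z) = 0 := fun y => by
      rcases le_or_gt x y with h1 | h1
      · simp [ker, not_lt.2 (sub_nonpos.2 h1)]
      · have : ¬ z < y := by linarith
        simp [ker, this]
    simp only [h0]
    exact integrable_zero _ _ _
  -- A non-integrable function has integral `0` by convention, but the value just computed is
  -- positive.
  · by_contra hn
    have := integral_undef hn
    rw [integral_ker_mul_ker hα hβ hx hz] at this
    exact (ker_pos (add_pos hα hβ) (sub_pos.2 h)).ne' this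

theorem ae_mem_Icc : ∀ᵐ x ∂unitMeasure, x ∈ Set.Icc (0 : ℝ) 1 :=
  ae_restrict_mem measurableSet_Icc

/-- The semigroup law `L^α L^β = L^(α+β)`. -/
theorem frac_mul_frac {α β : ℝ} (hα : 0 < α) (hβ : 0 < β) :
    frac α * frac β = frac (α + β) := by
  ext1 f
  rw [mul_apply_eq_comp]
  apply Lp.ext
  filter_upwards [frac_ae hα (frac β f), frac_ae (add_pos hα hβ) f, fracFun_ae α (frac β f),
    fracFun_ae (α + β) f, ae_integrable (add_pos hα hβ) (Lp.memLp f), ae_mem_Icc]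
    with x h1 h2 h3 h4 hi hx
  rw [h1, h2, h3, h4]
  have hker := measurable_ker α
  have hker' := measurable_ker β
  set F : ℝ → ℝ → ℂ := fun y z => ((ker α (x - y) * ker β (y - z) : ℝ) : ℂ) * f z with hF
  have hFm : AEStronglyMeasurable (Function.uncurry F) (unitMeasure.prod unitMeasure) := by
    refine AEStronglyMeasurable.mul ?_ (Lp.aestronglyMeasurable f).comp_snd
    exact (by fun_prop : Measurable fun p : ℝ × ℝ =>
      ((ker α (x - p.1) * ker β (p.1 - p.2) : ℝ) : ℂ)).aestronglyMeasurable
  have hFi : Integrable (Function.uncurry F) (unitMeasure.prod unitMeasure) := by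
    rw [integrable_prod_iff' hFm]
    refine ⟨?_, ?_⟩
    · filter_upwards [ae_mem_Icc] with z hz
      exact ((integrable_ker_mul_ker hα hβ hx hz).ofReal (𝕜 := ℂ)).mul_const (f z)
    -- Since the kernels are nonnegative, the inner integral of norms is `ker (α + β) (x - z) ‖f
    -- z‖`, integrable for almost every `x`.
    · refine hi.norm.congr ?_
      filter_upwards [ae_mem_Icc] with z hz
      simp only [Function.uncurry, hF, norm_mul, Complex.norm_real]
      rw [integral_mul_const, ← integral_ker_mul_ker hα hβ hx hz]
      congr 1
      rw [Real.norm_of_nonneg (integral_nonneg fun y =>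
        mul_nonneg (ker_nonneg hα _) (ker_nonneg hβ _))]
      refine integral_congr_ae (Eventually.of_forall fun y => ?_)
      simp only [Real.norm_of_nonneg (ker_nonneg hα _), Real.norm_of_nonneg (ker_nonneg hβ _)]
  calc ∫ y, ((ker α (x - y) : ℝ) : ℂ) * (frac β f) y ∂unitMeasure
      = ∫ y, ∫ z, F y z ∂unitMeasure ∂unitMeasure := by
        refine integral_congr_ae ?_
        filter_upwards [frac_ae hβ f, fracFun_ae β f] with y hy1 hy2
        rw [hy1, hy2, ← integral_const_mul]
        refine integral_congr_ae (Eventually.of_forall fun z => ?_)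
        simp only [hF]
        push_cast
        ring
    _ = ∫ z, ∫ y, F y z ∂unitMeasure ∂unitMeasure := integral_integral_swap hFi
    _ = ∫ z, ((ker (α + β) (x - z) : ℝ) : ℂ) * f z ∂unitMeasure := by
        refine integral_congr_ae ?_
        filter_upwards [ae_mem_Icc] with z hz
        simp only [hF]
        rw [integral_mul_const, integral_complex_ofReal, integral_ker_mul_ker hα hβ hx hz]

/-! ### Nonvanishing of `A` -/

/-- The constant function `1` of `L²([0,1])`. -/
noncomputable def one2 : L2 := (memLp_const (1 : ℂ)).toLp (fun _ => (1 : ℂ))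

theorem one2_ae : one2 =ᵐ[unitMeasure] fun _ => (1 : ℂ) := MemLp.coeFn_toLp _

theorem fracFun_one2 {α : ℝ} {x : ℝ} (hx : x ∈ Set.Icc (0 : ℝ) 1) :
    fracFun α one2 x = ((∫ y, ker α (x - y) ∂unitMeasure : ℝ) : ℂ) := by
  rw [fracFun_eq α _ hx, ← integral_complex_ofReal]
  refine integral_congr_ae ?_
  filter_upwards [one2_ae] with y hy
  rw [hy, mul_one]

theorem integral_ker_pos {α : ℝ} (hα : 0 < α) {x : ℝ} (hx : x ∈ Set.Ioc (0 : ℝ) 1) :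
    0 < ∫ y, ker α (x - y) ∂unitMeasure := by
  rw [integral_pos_iff_support_of_nonneg (fun y => ker_nonneg hα _)
    ((integrable_ker hα).comp_sub_left x).restrict]
  have hsub : Set.Ioo 0 x ⊆ Function.support fun y => ker α (x - y) := fun y hy =>
    (ker_pos hα (sub_pos.2 hy.2)).ne'
  refine lt_of_lt_of_le ?_ (measure_mono hsub)
  have hsub' : Set.Ioo 0 x ⊆ Set.Icc (0 : ℝ) 1 := fun y hy => ⟨hy.1.le, hy.2.le.trans hx.2⟩
  rw [Measure.restrict_apply measurableSet_Ioo, Set.inter_eq_left.2 hsub', Real.volume_Ioo]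
  simpa using hx.1

theorem re_inner_frac_pos {α : ℝ} (hα : 0 < α) :
    0 < (inner ℂ one2 (frac α one2)).re := by
  set G : ℝ → ℝ := fun x => ∫ y, ker α (x - y) ∂unitMeasure with hG
  have hae : (fun x => inner ℂ (one2 x) (frac α one2 x)) =ᵐ[unitMeasure]
      fun x => ((G x : ℝ) : ℂ) := by
    filter_upwards [one2_ae, frac_ae hα one2, ae_mem_Icc] with x h1 h2 hx
    rw [h1, h2, fracFun_one2 hx]
    simp [hG]
  have hint : Integrable (fun x => ((G x : ℝ) : ℂ)) unitMeasure :=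
    (L2.integrable_inner one2 (frac α one2)).congr hae
  have hint' : Integrable G unitMeasure := by simpa using hint.re
  rw [L2.inner_def, integral_congr_ae hae, integral_complex_ofReal, Complex.ofReal_re,
    integral_pos_iff_support_of_nonneg (fun x => integral_nonneg fun y => ker_nonneg hα _) hint']
  have hsub : Set.Ioc 0 1 ⊆ Function.support G := fun x hx => (integral_ker_pos hα hx).ne'
  refine lt_of_lt_of_le ?_ (measure_mono hsub)
  rw [Measure.restrict_apply measurableSet_Ioc, Set.inter_eq_left.2 Set.Ioc_subset_Icc_self,
    Real.volume_Ioc]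
  simp

/-- The functional `B ↦ Re ⟨1, B 1⟩` is strictly positive on every `L^α` and commutes with the
Bochner integral. -/
theorem opA_ne_zero (h : IntervalIntegrable frac volume (0 : ℝ) (1 / 2)) : opA ≠ 0 := by
  intro h0
  let Λ : (L2 →L[ℂ] L2) →L[ℝ] ℝ :=
    Complex.reCLM.comp ((innerSL ℂ one2 ∘L
      ContinuousLinearMap.apply ℂ L2 one2).restrictScalars ℝ)
  have hΛ : ∀ B, Λ B = (inner ℂ one2 (B one2)).re := fun B => rfl
  have h1 : Λ (∫ α in (0 : ℝ)..(1 / 2), frac α) = 0 := by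
    rw [opA, neg_eq_zero] at h0
    rw [h0, map_zero]
  rw [← Λ.intervalIntegral_comp_comm h] at h1
  refine (intervalIntegral.intervalIntegral_pos_of_pos_on
    ⟨Λ.integrable_comp h.1, Λ.integrable_comp h.2⟩ (fun α hα => ?_) (by norm_num)).ne' h1
  rw [hΛ]
  exact re_inner_frac_pos hα.1

open scoped SchwartzMap FourierTransform NNReal BoundedContinuousFunction ContDiff Convolution

/-! ### Fourier multipliers, test functions and weights -/

/-- The point `1 + l + 2πiξ` of the right half-plane. -/
noncomputable def linePoint (l : ℝ≥0) (ξ : ℝ) : ℂ := 1 + l + (2 * Real.pi * ξ : ℝ) * Complex.I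

theorem linePoint_re (l : ℝ≥0) (ξ : ℝ) : (linePoint l ξ).re = 1 + l := by
  simp [linePoint]

theorem one_le_linePoint_re (l : ℝ≥0) (ξ : ℝ) : 1 ≤ (linePoint l ξ).re := by
  rw [linePoint_re]; linarith [l.2]

theorem linePoint_re_pos (l : ℝ≥0) (ξ : ℝ) : 0 < (linePoint l ξ).re :=
  one_pos.trans_le (one_le_linePoint_re l ξ)

theorem continuous_linePoint (l : ℝ≥0) : Continuous (linePoint l) := by
  unfold linePoint; fun_prop

/-- The Fourier multiplier `(1 + l + 2πiξ) ^ (-|α|)`. -/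
noncomputable def mult (l : ℝ≥0) (α : ℝ) : ℝ →ᵇ ℂ :=
  -- The absolute value keeps the function bounded by `1` for every real `α`, so no sign hypothesis
  -- enters the definition.
  BoundedContinuousFunction.ofNormedAddCommGroup (fun ξ => linePoint l ξ ^ (-((|α| : ℝ) : ℂ)))
    ((continuous_linePoint l).cpow continuous_const fun ξ => Or.inl (linePoint_re_pos l ξ)) 1
    fun ξ => by
      rw [norm_cpow_neg (linePoint_re_pos l ξ)]
      exact Real.exp_le_one_iff.2 (neg_nonpos.2
        (mul_nonneg (abs_nonneg _) (log_norm_nonneg (one_le_linePoint_re l ξ))))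

theorem mult_apply (l : ℝ≥0) {α : ℝ} (hα : 0 ≤ α) (ξ : ℝ) :
    mult l α ξ = linePoint l ξ ^ (-(α : ℂ)) := by
  simp [mult, abs_of_nonneg hα]

theorem norm_mult_le (l : ℝ≥0) (α : ℝ) : ‖mult l α‖ ≤ 1 :=
  BoundedContinuousFunction.norm_ofNormedAddCommGroup_le _ zero_le_one _

theorem mult_mul_mult (l : ℝ≥0) {α β : ℝ} (hα : 0 ≤ α) (hβ : 0 ≤ β) :
    mult l α * mult l β = mult l (α + β) := by
  ext ξ
  have h0 : linePoint l ξ ≠ 0 := fun h => by simpa [h] using linePoint_re_pos l ξ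
  rw [BoundedContinuousFunction.mul_apply, mult_apply l hα, mult_apply l hβ,
    mult_apply l (add_nonneg hα hβ), ← Complex.cpow_add _ _ h0]
  congr 1
  push_cast; ring

theorem norm_mult_sub_le (l : ℝ≥0) {δ α β : ℝ} (hδ : 0 < δ) (hα : δ ≤ α) (hβ : δ ≤ β) :
    ‖mult l α - mult l β‖ ≤ (1 / δ + 4) * |α - β| := by
  refine (BoundedContinuousFunction.norm_le (by positivity)).2 fun ξ => ?_
  rw [BoundedContinuousFunction.sub_apply, mult_apply l (hδ.le.trans hα),
    mult_apply l (hδ.le.trans hβ)]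
  exact norm_cpow_neg_sub_le (one_le_linePoint_re l ξ) hδ hα hβ

/-- The Schwartz functions vanishing outside `[0,1]`. -/
def testSpace : Submodule ℂ 𝓢(ℝ, ℂ) where
  carrier := {F | ∀ x ∉ Set.Icc (0 : ℝ) 1, F x = 0}
  add_mem' {F G} hF hG x hx := by simp [hF x hx, hG x hx]
  zero_mem' x _ := rfl
  smul_mem' c F hF x hx := by simp [hF x hx]

/-- Test functions as elements of `L²([0,1])`. -/
noncomputable def testLp : testSpace →ₗ[ℂ] L2 :=
  (SchwartzMap.toLpCLM ℂ ℂ 2 unitMeasure).toLinearMap.comp testSpace.subtype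

theorem testLp_ae (F : testSpace) : testLp F =ᵐ[unitMeasure] F.1 :=
  SchwartzMap.coeFn_toLp F.1 2 unitMeasure

theorem denseRange_testLp : DenseRange testLp := by
  have hperp : (LinearMap.range testLp)ᗮ = ⊥ := by
    rw [Submodule.eq_bot_iff]
    intro f hf
    have hint : IntegrableOn f (Set.Ioo (0 : ℝ) 1) := by
      have h1 : Integrable f unitMeasure := (Lp.memLp f).integrable one_le_two
      exact IntegrableOn.mono_set h1 Set.Ioo_subset_Icc_self
    have key := isOpen_Ioo.ae_eq_zero_of_integral_contDiff_smul_eq_zero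
      (hint.locallyIntegrableOn) (fun g hg hc hs => ?_)
    · apply Lp.ext
      have h2 : ∀ᵐ x ∂(volume.restrict (Set.Ioo (0 : ℝ) 1)), f x = 0 :=
        (ae_restrict_iff' measurableSet_Ioo).2 key
      rw [restrict_Ioo_eq_restrict_Icc] at h2
      filter_upwards [h2, Lp.coeFn_zero ℂ 2 unitMeasure] with x hx h0
      rw [hx, h0]; rfl
    · have hg0 : ∀ x ∉ Set.Icc (0 : ℝ) 1, g x = 0 := fun x hx =>
        image_eq_zero_of_notMem_tsupport fun h => hx (Set.Ioo_subset_Icc_self (hs h))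
      have hc' : HasCompactSupport fun x => (g x : ℂ) :=
        hc.comp_left (g := fun r : ℝ => (r : ℂ)) Complex.ofReal_zero
      have hd' : ContDiff ℝ ∞ fun x => (g x : ℂ) := Complex.ofRealCLM.contDiff.comp hg
      let G : testSpace := ⟨hc'.toSchwartzMap hd', fun x hx => by
        change ((g x : ℝ) : ℂ) = 0
        rw [hg0 x hx]; simp⟩
      have hG : ∀ x, G.1 x = (g x : ℂ) := fun x => rfl
      have h1 : inner ℂ (testLp G) f = 0 := hf _ ⟨G, rfl⟩
      rw [L2.inner_def] at h1
      rw [← h1, ← setIntegral_eq_integral_of_forall_compl_eq_zero (s := Set.Icc (0 : ℝ) 1)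
        (fun x hx => by rw [hg0 x hx, zero_smul])]
      refine integral_congr_ae ?_
      filter_upwards [testLp_ae G] with x hx
      rw [hx, hG]
      simp [mul_comm]
  have := Submodule.topologicalClosure_eq_top_iff.2 hperp
  have h2 : Dense (LinearMap.range testLp : Set L2) :=
    Submodule.dense_iff_topologicalClosure_eq_top.2 this
  rwa [LinearMap.coe_range] at h2

/-- The test function `x ↦ e ^ (lx) F(x)`, for `F` vanishing outside `[0,1]`. -/
noncomputable def weight (l : ℝ) (F : testSpace) : 𝓢(ℝ, ℂ) :=
  HasCompactSupport.toSchwartzMap (f := fun x => ((Real.exp (l * x) : ℝ) : ℂ) * F.1 x)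
    (HasCompactSupport.intro isCompact_Icc fun x hx => by rw [F.2 x hx, mul_zero])
    ((Complex.ofRealCLM.contDiff.comp (Real.contDiff_exp.comp (contDiff_const.mul contDiff_id))).mul
      (F.1.smooth _))

theorem weight_apply (l : ℝ) (F : testSpace) (x : ℝ) :
    weight l F x = ((Real.exp (l * x) : ℝ) : ℂ) * F.1 x := rfl

theorem norm_weight_toLp_le (l : ℝ) {C : ℝ} (hC : ∀ x ∈ Set.Icc (0 : ℝ) 1, Real.exp (l * x) ≤ C)
    (F : testSpace) : ‖(weight l F).toLp 2‖ ≤ C * ‖testLp F‖ := by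
  have hC0 : 0 ≤ C := (Real.exp_pos _).le.trans (hC 0 (by simp))
  rw [SchwartzMap.norm_toLp]
  change _ ≤ C * ‖F.1.toLp 2 unitMeasure‖
  rw [SchwartzMap.norm_toLp, ← ENNReal.toReal_ofReal hC0, ← ENNReal.toReal_mul]
  refine ENNReal.toReal_mono (ENNReal.mul_ne_top ENNReal.ofReal_ne_top
    (F.1.memLp 2 unitMeasure).2.ne) ?_
  have hsupp : Function.support (weight l F) ⊆ Set.Icc (0 : ℝ) 1 := fun x hx => by
    by_contra h
    exact hx (by rw [weight_apply, F.2 x h, mul_zero])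
  rw [← eLpNorm_restrict_eq_of_support_subset hsupp]
  refine eLpNorm_le_mul_eLpNorm_of_ae_le_mul ?_ 2
  filter_upwards [ae_mem_Icc] with x hx
  rw [weight_apply, norm_mul, Complex.norm_real, Real.norm_of_nonneg (Real.exp_pos _).le]
  exact mul_le_mul_of_nonneg_right (hC x hx) (norm_nonneg _)

/-- Parseval with one factor merely integrable, the regularity at hand for a convolution with
`weightedKer`. -/
theorem integral_inner_fourier_schwartz {u : ℝ → ℂ} (hu : Integrable u) (φ : 𝓢(ℝ, ℂ)) :
    ∫ ξ, inner ℂ (𝓕 u ξ) (𝓕 φ ξ) = ∫ x, inner ℂ (u x) (φ x) := by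
  have h : ∀ ψ : 𝓢(ℝ, ℂ), ∫ ξ, innerSL ℂ (𝓕 u ξ) (ψ ξ) = ∫ x, innerSL ℂ (u x) ((𝓕⁻ ψ) x) :=
    fun ψ => by
      have hi : Integrable ψ volume := ψ.integrable
      simpa [SchwartzMap.fourierInv_coe] using!
        VectorFourier.integral_sesq_fourierIntegral_eq_neg_flip (innerSL ℂ)
          (L := innerₗ ℝ) Real.continuous_fourierChar continuous_inner hu hi
  simpa using h (𝓕 φ)

theorem integral_norm_mul_norm_le (a b : 𝓢(ℝ, ℂ)) :
    ∫ x, ‖a x‖ * ‖b x‖ ≤ ‖a.toLp 2‖ * ‖b.toLp 2‖ := by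
  have h := integral_mul_norm_le_Lp_mul_Lq (μ := volume) (f := a) (g := b)
    Real.HolderConjugate.two_two (by simpa using a.memLp 2 volume) (by simpa using b.memLp 2 volume)
  rw [SchwartzMap.norm_toLp' two_ne_zero ENNReal.ofNat_ne_top,
    SchwartzMap.norm_toLp' two_ne_zero ENNReal.ofNat_ne_top]
  simpa using h

/-! ### Operators as compressions of multipliers -/

/-- Bounded operators on `L²([0,1])` paired with bounded continuous symbols. -/
abbrev OpSymbol : Type := (L2 →L[ℂ] L2) × (ℝ →ᵇ ℂ)

/-- On test functions, `p.1` is the compression of the Fourier multiplier `p.2` after conjugation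
with the weight `e ^ (-lx)`. -/
def IsCompression (l : ℝ≥0) (p : OpSymbol) : Prop :=
  ∀ F φ : testSpace, inner ℂ (p.1 (testLp F)) (testLp φ)
    = ∫ ξ, inner ℂ (p.2 ξ * 𝓕 (weight (-l) F) ξ) (𝓕 (weight l φ) ξ)

theorem integrable_inner_symbol (m : ℝ →ᵇ ℂ) (a b : 𝓢(ℝ, ℂ)) :
    Integrable fun ξ => inner ℂ (m ξ * a ξ) (b ξ) := by
  have h1 : MemLp (fun ξ => m ξ * a ξ) 2 := by
    refine (a.memLp 2).of_le_mul (c := ‖m‖)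
      ((m.continuous.mul a.continuous).aestronglyMeasurable) (Eventually.of_forall fun ξ => ?_)
    rw [norm_mul]
    exact mul_le_mul_of_nonneg_right (m.norm_coe_le_norm ξ) (norm_nonneg _)
  have h2 := h1.star.integrable_mul (b.memLp 2)
  refine h2.congr (Eventually.of_forall fun ξ => ?_)
  simp [mul_comm]

/-- On `[0,1]` the weight `e ^ (-lx)` is at most `1` and `e ^ (lx)` at most `e ^ l`; Cauchy–Schwarz
and Plancherel do the rest on test functions, and density extends the bound. -/
theorem IsCompression.norm_le {l : ℝ≥0} {p : OpSymbol} (h : IsCompression l p) :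
    ‖p.1‖ ≤ Real.exp l * ‖p.2‖ := by
  have hl : (0 : ℝ) ≤ l := l.2
  have h1 : ∀ F φ : testSpace, ‖inner ℂ (p.1 (testLp F)) (testLp φ)‖
      ≤ Real.exp l * ‖p.2‖ * (‖testLp F‖ * ‖testLp φ‖) := fun F φ => by
    have hF := norm_weight_toLp_le (-l) (C := 1) (fun x hx => Real.exp_le_one_iff.2
      (by nlinarith [hx.1])) F
    have hφ := norm_weight_toLp_le l (C := Real.exp l) (fun x hx => Real.exp_le_exp.2
      (by nlinarith [hx.2])) φ
    rw [h F φ]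
    calc ‖∫ ξ, inner ℂ (p.2 ξ * 𝓕 (weight (-l) F) ξ) (𝓕 (weight l φ) ξ)‖
        ≤ ∫ ξ, ‖p.2‖ * (‖𝓕 (weight (-l) F) ξ‖ * ‖𝓕 (weight l φ) ξ‖) := by
          refine norm_integral_le_of_norm_le ?_ (Eventually.of_forall fun ξ => ?_)
          · refine Integrable.const_mul ?_ _
            exact ((𝓕 (weight (-l) F)).memLp 2).norm.integrable_mul
              ((𝓕 (weight l φ)).memLp 2).norm
          · refine (norm_inner_le_norm _ _).trans ?_
            rw [norm_mul, mul_assoc]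
            exact mul_le_mul_of_nonneg_right (p.2.norm_coe_le_norm ξ) (by positivity)
      _ ≤ ‖p.2‖ * (‖(weight (-l) F).toLp 2‖ * ‖(weight l φ).toLp 2‖) := by
          rw [integral_const_mul]
          refine mul_le_mul_of_nonneg_left ?_ (norm_nonneg _)
          refine (integral_norm_mul_norm_le _ _).trans (le_of_eq ?_)
          rw [SchwartzMap.norm_fourier_toL2_eq, SchwartzMap.norm_fourier_toL2_eq]
      _ ≤ ‖p.2‖ * ((1 * ‖testLp F‖) * (Real.exp l * ‖testLp φ‖)) := by gcongr
      _ = _ := by ring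
  have h2 : ∀ f g : L2, ‖inner ℂ (p.1 f) g‖ ≤ Real.exp l * ‖p.2‖ * (‖f‖ * ‖g‖) := fun f g =>
    denseRange_testLp.induction_on₂
      (p := fun f g => ‖inner ℂ (p.1 f) g‖ ≤ Real.exp l * ‖p.2‖ * (‖f‖ * ‖g‖))
      (isClosed_le (by fun_prop) (by fun_prop)) h1 f g
  refine ContinuousLinearMap.opNorm_le_bound _ (by positivity) fun f => ?_
  have h3 := h2 f (p.1 f)
  rw [inner_self_eq_norm_sq_to_K] at h3
  simp only [Complex.coe_algebraMap, norm_pow, Complex.norm_real, norm_norm] at h3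
  rcases (norm_nonneg (p.1 f)).eq_or_lt with h0 | h0
  · rw [← h0]; positivity
  · nlinarith

theorem IsCompression.one (l : ℝ≥0) : IsCompression l 1 := fun F φ => by
  have h := integral_inner_fourier_schwartz (weight (-l) F).integrable (weight l φ)
  rw [← SchwartzMap.fourier_coe] at h
  simp only [Prod.fst_one, Prod.snd_one, one_apply_eq_self, BoundedContinuousFunction.coe_one,
    Pi.one_apply, one_mul]
  rw [h, L2.inner_def, ← setIntegral_eq_integral_of_forall_compl_eq_zero (μ := volume)
    (s := Set.Icc (0 : ℝ) 1) (f := fun x => inner ℂ (weight (-l) F x) (weight l φ x))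
    (fun x hx => by rw [weight_apply, F.2 x hx, mul_zero, inner_zero_left])]
  refine integral_congr_ae ?_
  filter_upwards [testLp_ae F, testLp_ae φ] with x h1 h2
  have hE : ((Real.exp (l * x) : ℝ) : ℂ) * ((Real.exp (-l * x) : ℝ) : ℂ) = 1 := by
    rw [← Complex.ofReal_mul, ← Real.exp_add]; simp
  rw [h1, h2, weight_apply, weight_apply]
  simp only [RCLike.inner_apply, map_mul, Complex.conj_ofReal]
  linear_combination -(φ.1 x * (starRingEnd ℂ) (F.1 x)) * hE

theorem IsCompression.add {l : ℝ≥0} {p q : OpSymbol} (hp : IsCompression l p)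
    (hq : IsCompression l q) : IsCompression l (p + q) := fun F φ => by
  simp only [Prod.fst_add, Prod.snd_add, add_apply, inner_add_left,
    BoundedContinuousFunction.add_apply, add_mul]
  rw [integral_add (integrable_inner_symbol _ _ _) (integrable_inner_symbol _ _ _), hp F φ, hq F φ]

theorem IsCompression.smul {l : ℝ≥0} {p : OpSymbol} (c : ℂ) (hp : IsCompression l p) :
    IsCompression l (c • p) := fun F φ => by
  simp only [Prod.smul_fst, Prod.smul_snd, smul_apply,
    BoundedContinuousFunction.smul_apply, smul_mul_assoc, inner_smul_left]
  rw [integral_const_mul, hp F φ]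

theorem IsCompression.zero (l : ℝ≥0) : IsCompression l 0 := by
  simpa using (IsCompression.one l).smul 0

/-- The kernel `e ^ (-ls) ker α s`. -/
noncomputable def weightedKer (l : ℝ≥0) (α s : ℝ) : ℂ := ((Real.exp (-l * s) * ker α s : ℝ) : ℂ)

theorem integrable_weightedKer (l : ℝ≥0) {α : ℝ} (hα : 0 < α) :
    Integrable (weightedKer l α) := by
  refine Integrable.ofReal (f := fun s => Real.exp (-l * s) * ker α s) ?_
  refine (integrable_ker hα).mono' ?_ (Eventually.of_forall fun s => ?_)
  · have := measurable_ker α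
    exact (by fun_prop : Measurable fun s => Real.exp (-l * s) * ker α s).aestronglyMeasurable
  · rcases le_or_gt s 0 with hs | hs
    · simp [ker, not_lt.2 hs]
    · rw [norm_mul, Real.norm_of_nonneg (ker_nonneg hα s), Real.norm_of_nonneg (Real.exp_pos _).le]
      refine mul_le_of_le_one_left (ker_nonneg hα s) (Real.exp_le_one_iff.2 ?_)
      have : (0 : ℝ) ≤ l := l.2
      nlinarith

theorem fourier_weightedKer (l : ℝ≥0) {α : ℝ} (hα : 0 < α) (ξ : ℝ) :
    𝓕 (weightedKer l α) ξ = mult l α ξ := by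
  have hΓ : ((Real.Gamma α : ℝ) : ℂ) ≠ 0 := by
    exact_mod_cast (Real.Gamma_pos_of_pos hα).ne'
  rw [mult_apply l hα.le, Real.fourier_real_eq_integral_exp_smul,
    ← mul_div_cancel_right₀ (linePoint l ξ ^ (-(α : ℂ))) hΓ,
    ← integral_rpow_mul_cexp_neg_mul hα (linePoint_re_pos l ξ), div_eq_inv_mul,
    ← integral_const_mul, ← integral_indicator measurableSet_Ioi]
  congr 1
  ext s
  by_cases hs : 0 < s
  · rw [Set.indicator_of_mem (Set.mem_Ioi.2 hs), weightedKer, ker, if_pos hs, smul_eq_mul]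
    have hE : Complex.exp (-(linePoint l ξ * s))
        = Complex.exp ((-2 * Real.pi * s * ξ : ℝ) * Complex.I) * Complex.exp (-l * s)
          * Complex.exp (-s) := by
      rw [← Complex.exp_add, ← Complex.exp_add, linePoint]
      congr 1; push_cast; ring
    rw [hE]
    push_cast
    ring
  · rw [Set.indicator_of_notMem (s := Set.Ioi (0 : ℝ)) hs]
    simp [weightedKer, ker, hs]

/-- Splitting `e ^ (-lx) = e ^ (-l(x-y)) e ^ (-ly)` turns the weighted operator into convolution
with `weightedKer`. Only its values on `[0,1]` are seen, because `φ` vanishes elsewhere. -/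
theorem IsCompression.frac (l : ℝ≥0) {α : ℝ} (hα : 0 < α) :
    IsCompression l (frac α, mult l α) := fun F φ => by
  have hk := integrable_weightedKer l hα
  set u : ℝ → ℂ := weightedKer l α ⋆[ContinuousLinearMap.mul ℂ ℂ] (weight (-l) F) with hu
  have hui : Integrable u := hk.integrable_convolution _ (weight (-l) F).integrable
  have hF : ∀ ξ, mult l α ξ * 𝓕 (weight (-l) F) ξ = 𝓕 u ξ := fun ξ => by
    rw [hu, Real.fourier_mul_convolution_eq hk (weight (-l) F).integrable, fourier_weightedKer l hα,
      SchwartzMap.fourier_coe]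
  simp only [hF]
  rw [integral_inner_fourier_schwartz hui, L2.inner_def,
    ← setIntegral_eq_integral_of_forall_compl_eq_zero (μ := volume) (s := Set.Icc (0 : ℝ) 1)
    (f := fun x => inner ℂ (u x) (weight l φ x))
    (fun x hx => by rw [weight_apply, φ.2 x hx, mul_zero, inner_zero_right])]
  refine integral_congr_ae ?_
  filter_upwards [testLp_ae φ, frac_ae hα (testLp F), ae_mem_Icc] with x h1 h2 hx
  have hux : u x = ((Real.exp (-l * x) : ℝ) : ℂ) * fracFun α (testLp F) x := by
    rw [fracFun_eq α _ hx, hu, convolution_eq_swap, ← integral_const_mul]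
    have e1 : ∫ y, ((Real.exp (-l * x) : ℝ) : ℂ) *
        (((ker α (x - y) : ℝ) : ℂ) * testLp F y) ∂unitMeasure
        = ∫ y in Set.Icc (0 : ℝ) 1, ((Real.exp (-l * x) : ℝ) : ℂ) *
        (((ker α (x - y) : ℝ) : ℂ) * F.1 y) := by
      refine integral_congr_ae ?_
      filter_upwards [testLp_ae F] with y hy
      rw [hy]
    rw [e1, setIntegral_eq_integral_of_forall_compl_eq_zero
      (fun y hy => by rw [F.2 y hy, mul_zero, mul_zero])]
    congr 1
    ext y
    rw [ContinuousLinearMap.mul_apply', weight_apply, weightedKer]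
    have hE : Real.exp (-l * x) = Real.exp (-l * (x - y)) * Real.exp (-l * y) := by
      rw [← Real.exp_add]; congr 1; ring
    rw [hE]
    push_cast
    ring
  have hE : ((Real.exp (l * x) : ℝ) : ℂ) * ((Real.exp (-l * x) : ℝ) : ℂ) = 1 := by
    rw [← Complex.ofReal_mul, ← Real.exp_add]; simp
  rw [h1, h2, hux, weight_apply]
  simp only [RCLike.inner_apply, map_mul, Complex.conj_ofReal]
  linear_combination -(φ.1 x * (starRingEnd ℂ) (fracFun α (testLp F) x)) * hE

open scoped NNReal BoundedContinuousFunction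

/-! ### The closed algebra and its von Neumann inequality -/

/-- The operator `L^α` together with its symbol on the line `Re w = 1 + l`. -/
noncomputable def fracPair (l : ℝ≥0) (α : ℝ) : OpSymbol := (frac α, mult l α)

theorem fracPair_mul_fracPair (l : ℝ≥0) {α β : ℝ} (hα : 0 < α) (hβ : 0 < β) :
    fracPair l α * fracPair l β = fracPair l (α + β) :=
  Prod.ext (frac_mul_frac hα hβ) (mult_mul_mult l hα.le hβ.le)

/-- The semigroup formed by the `L^α` and the identity, with symbols. -/
def fracMonoid (l : ℝ≥0) : Submonoid OpSymbol where
  carrier := {p | p = 1 ∨ ∃ α > 0, p = fracPair l α}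
  one_mem' := Or.inl rfl
  mul_mem' := by
    rintro p q (rfl | ⟨α, hα, rfl⟩) hq
    · simpa using hq
    · rcases hq with rfl | ⟨β, hβ, rfl⟩
      · exact Or.inr ⟨α, hα, mul_one _⟩
      · exact Or.inr ⟨α + β, add_pos hα hβ, fracPair_mul_fracPair l hα hβ⟩

/-- The closed algebra generated by the `L^α`, with symbols. -/
noncomputable def fracAlgebra (l : ℝ≥0) : Subalgebra ℂ OpSymbol :=
  (Algebra.adjoin ℂ (fracMonoid l : Set OpSymbol)).topologicalClosure

/-- The generators form a monoid, so the algebra is their linear span. Linearity of `IsCompression`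
in `p` is therefore enough; it need not be multiplicative. -/
theorem isCompression_of_mem_adjoin {l : ℝ≥0} {p : OpSymbol}
    (hp : p ∈ Algebra.adjoin ℂ (fracMonoid l : Set OpSymbol)) : IsCompression l p := by
  rw [← Subalgebra.mem_toSubmodule, Algebra.adjoin_eq_span, Submonoid.closure_eq] at hp
  induction hp using Submodule.span_induction with
  | mem x hx =>
    rcases hx with rfl | ⟨α, hα, rfl⟩
    · exact IsCompression.one l
    · exact IsCompression.frac l hα
  | zero => exact IsCompression.zero l
  | add x y _ _ hx hy => exact hx.add hy
  | smul c x _ hx => exact hx.smul c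

/-- A von Neumann type inequality on the closed algebra generated by the `L^α`. -/
theorem norm_fst_le_of_mem {l : ℝ≥0} {p : OpSymbol} (hp : p ∈ fracAlgebra l) :
    ‖p.1‖ ≤ Real.exp l * ‖p.2‖ := by
  have hclosed : IsClosed {p : OpSymbol | ‖p.1‖ ≤ Real.exp l * ‖p.2‖} :=
    isClosed_le (by fun_prop) (by fun_prop)
  exact closure_minimal (fun q hq => (isCompression_of_mem_adjoin hq).norm_le) hclosed hp

theorem fracPair_mem (l : ℝ≥0) {α : ℝ} (hα : 0 < α) : fracPair l α ∈ fracAlgebra l :=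
  Subalgebra.le_topologicalClosure _ (Algebra.subset_adjoin (Or.inr ⟨α, hα, rfl⟩))

theorem isClosed_fracAlgebra (l : ℝ≥0) : IsClosed (fracAlgebra l : Set OpSymbol) :=
  Subalgebra.isClosed_topologicalClosure _

/-- Lets continuity and boundedness of operator-symbol pairs be read off from scalar estimates on
the symbols. -/
theorem norm_le_of_mem {l : ℝ≥0} {p : OpSymbol} (hp : p ∈ fracAlgebra l) :
    ‖p‖ ≤ Real.exp l * ‖p.2‖ := by
  refine (Prod.norm_def p).le.trans (max_le (norm_fst_le_of_mem hp) ?_)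
  exact le_mul_of_one_le_left (norm_nonneg _) (Real.one_le_exp l.2)

theorem norm_fracPair_sub_le (l : ℝ≥0) {δ α β : ℝ} (hδ : 0 < δ) (hα : δ ≤ α) (hβ : δ ≤ β) :
    ‖fracPair l α - fracPair l β‖ ≤ Real.exp l * ((1 / δ + 4) * |α - β|) :=
  (norm_le_of_mem (sub_mem (fracPair_mem l (hδ.trans_le hα))
    (fracPair_mem l (hδ.trans_le hβ)))).trans
    (mul_le_mul_of_nonneg_left (norm_mult_sub_le l hδ hα hβ) (Real.exp_pos _).le)

theorem continuousOn_fracPair (l : ℝ≥0) : ContinuousOn (fracPair l) (Set.Ioi 0) := by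
  intro α hα
  have hα0 : 0 < α := hα
  have hδ : 0 < α / 2 := half_pos hα0
  refine ContinuousAt.continuousWithinAt ?_
  rw [ContinuousAt, tendsto_iff_norm_sub_tendsto_zero]
  have hlim : Tendsto (fun β : ℝ => Real.exp l * ((1 / (α / 2) + 4) * |β - α|)) (𝓝 α) (𝓝 0) := by
    have : Continuous fun β : ℝ => Real.exp l * ((1 / (α / 2) + 4) * |β - α|) := by fun_prop
    simpa using this.tendsto α
  refine squeeze_zero' (Eventually.of_forall fun β => norm_nonneg _) ?_ hlim
  filter_upwards [lt_mem_nhds (half_lt_self hα0)] with β hβ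
  exact norm_fracPair_sub_le l hδ hβ.le (half_lt_self hα0).le

/-- Norm continuity on `(0,∞)` gives measurability, and the uniform bound `e ^ l` makes continuity
at `0` unnecessary. -/
theorem intervalIntegrable_fracPair (l : ℝ≥0) :
    IntervalIntegrable (fracPair l) volume (0 : ℝ) (1 / 2) := by
  rw [intervalIntegrable_iff_integrableOn_Ioc_of_le (by norm_num)]
  refine Integrable.of_bound (C := Real.exp l) ?_ ?_
  · exact ((continuousOn_fracPair l).mono fun α hα => hα.1).aestronglyMeasurable measurableSet_Ioc
  · refine (ae_restrict_iff' measurableSet_Ioc).2 (Eventually.of_forall fun α hα => ?_)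
    exact (norm_le_of_mem (fracPair_mem l hα.1)).trans
      (mul_le_of_le_one_right (Real.exp_pos _).le (norm_mult_le l α))

theorem intervalIntegrable_frac : IntervalIntegrable frac volume (0 : ℝ) (1 / 2) := by
  have h := intervalIntegrable_fracPair 0
  exact ⟨h.1.fst, h.2.fst⟩

/-! ### `A`, `T` and their symbols -/

/-- The operator `A` together with its symbol on the line `Re w = 1 + l`. -/
noncomputable def pairA (l : ℝ≥0) : OpSymbol := -∫ α in (0 : ℝ)..(1 / 2), fracPair l α

theorem pairA_mem (l : ℝ≥0) : pairA l ∈ fracAlgebra l := by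
  refine neg_mem ?_
  have hI := intervalIntegrable_fracPair l
  rw [intervalIntegrable_iff_integrableOn_Ioc_of_le (by norm_num)] at hI
  -- The mean over `(0, 1/2]` stays in a closed convex set; rescaling by the length `1/2` recovers
  -- the integral.
  have hconv : Convex ℝ (fracAlgebra l : Set OpSymbol) :=
    ((Subalgebra.toSubmodule (fracAlgebra l)).restrictScalars ℝ).convex
  have h := hconv.set_average_mem (isClosed_fracAlgebra l) (μ := volume)
    (t := Set.Ioc (0 : ℝ) (1 / 2)) (f := fracPair l) (by simp) (by simp)
    ((ae_restrict_iff' measurableSet_Ioc).2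
      (Eventually.of_forall fun α hα => fracPair_mem l hα.1)) hI
  rw [setAverage_eq] at h
  rw [intervalIntegral.integral_of_le (by norm_num)]
  have h2 := ((Subalgebra.toSubmodule (fracAlgebra l)).restrictScalars ℝ).smul_mem (1 / 2 : ℝ) h
  rw [smul_smul] at h2
  simpa using h2

theorem pairA_fst (l : ℝ≥0) : (pairA l).1 = opA := by
  have h := (ContinuousLinearMap.fst ℝ (L2 →L[ℂ] L2) (ℝ →ᵇ ℂ)).intervalIntegral_comp_comm
    (intervalIntegrable_fracPair l)
  rw [pairA, opA, Prod.fst_neg]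
  exact congrArg Neg.neg h.symm

theorem pairA_snd (l : ℝ≥0) (ξ : ℝ) : (pairA l).2 ξ = -symbol (linePoint l ξ) := by
  have h := ((BoundedContinuousFunction.evalCLM ℝ ξ).comp
    (ContinuousLinearMap.snd ℝ (L2 →L[ℂ] L2) (ℝ →ᵇ ℂ))).intervalIntegral_comp_comm
    (intervalIntegrable_fracPair l)
  rw [pairA, Prod.snd_neg, BoundedContinuousFunction.neg_apply, symbol]
  refine congrArg Neg.neg (h.symm.trans ?_)
  refine intervalIntegral.integral_congr fun α hα => ?_
  rw [Set.uIcc_of_le (by norm_num)] at hα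
  exact mult_apply l hα.1 ξ

theorem exp_mem_fracAlgebra {l : ℝ≥0} {p : OpSymbol} (hp : p ∈ fracAlgebra l) :
    NormedSpace.exp p ∈ fracAlgebra l := by
  let _ : NormedAlgebra ℚ OpSymbol := NormedAlgebra.restrictScalars ℚ ℂ OpSymbol
  exact NormedSpace.exp_mem (R := ℂ) (isClosed_fracAlgebra l) hp

theorem fst_exp_opSymbol (p : OpSymbol) : (NormedSpace.exp p).1 = NormedSpace.exp p.1 := by
  let _ : NormedAlgebra ℚ (L2 →L[ℂ] L2) := NormedAlgebra.restrictScalars ℚ ℂ _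
  let _ : NormedAlgebra ℚ (ℝ →ᵇ ℂ) := NormedAlgebra.restrictScalars ℚ ℂ _
  exact Prod.fst_exp p

theorem snd_exp_opSymbol (p : OpSymbol) (ξ : ℝ) :
    (NormedSpace.exp p).2 ξ = Complex.exp (p.2 ξ) := by
  let _ : NormedAlgebra ℚ (L2 →L[ℂ] L2) := NormedAlgebra.restrictScalars ℚ ℂ _
  let _ : NormedAlgebra ℚ (ℝ →ᵇ ℂ) := NormedAlgebra.restrictScalars ℚ ℂ _
  let ev : (ℝ →ᵇ ℂ) →+* ℂ :=
    { toFun := fun f => f ξ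
      map_one' := rfl
      map_mul' := fun _ _ => rfl
      map_zero' := rfl
      map_add' := fun _ _ => rfl }
  have hev : Continuous ev := (BoundedContinuousFunction.evalCLM ℂ ξ).continuous
  rw [Prod.snd_exp, Complex.exp_eq_exp_ℂ]
  exact NormedSpace.map_exp ev hev p.2

theorem fst_exp_pairA (l : ℝ≥0) : (NormedSpace.exp (pairA l)).1 = opT := by
  rw [fst_exp_opSymbol, pairA_fst, opT]

/-! ### Growth estimates, on the line `l = 0` -/

theorem eventually_norm_mul_exp_le {ε : ℝ} (hε : 0 < ε) :
    ∀ᶠ t : ℝ in atTop, t * ‖opA * NormedSpace.exp ((t : ℂ) • opA)‖ ≤ 1 / Real.exp 1 + ε := by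
  filter_upwards [eventually_mul_norm_symbol_le hε, eventually_gt_atTop 0] with t ht ht0
  set p : OpSymbol := pairA 0 * NormedSpace.exp ((t : ℂ) • pairA 0) with hp
  have hmem : p ∈ fracAlgebra 0 :=
    mul_mem (pairA_mem 0) (exp_mem_fracAlgebra ((fracAlgebra 0).smul_mem (pairA_mem 0) _))
  have hfst : p.1 = opA * NormedSpace.exp ((t : ℂ) • opA) := by
    rw [hp, Prod.fst_mul, fst_exp_opSymbol, Prod.smul_fst, pairA_fst]
  have hsnd : ‖p.2‖ ≤ (1 / Real.exp 1 + ε) / t := by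
    refine (BoundedContinuousFunction.norm_le (by positivity)).2 fun ξ => ?_
    rw [le_div_iff₀ ht0, mul_comm, hp, Prod.snd_mul, BoundedContinuousFunction.mul_apply,
      snd_exp_opSymbol, Prod.smul_snd, BoundedContinuousFunction.smul_apply, pairA_snd, norm_mul,
      norm_neg, Complex.norm_exp]
    simpa using ht _ (one_le_linePoint_re 0 ξ)
  have h := norm_fst_le_of_mem hmem
  rw [hfst, NNReal.coe_zero, Real.exp_zero, one_mul] at h
  have := h.trans hsnd
  rwa [le_div_iff₀ ht0, mul_comm] at this

/-- The symbol is `e ^ (-ns) (e ^ (-s) - 1)`, and `|e ^ (-s) - 1| ≤ |s|` for `Re s ≥ 0` reduces it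
to the continuous-time bound at `t = n`. -/
theorem eventually_norm_pow_sub_le {ε : ℝ} (hε : 0 < ε) :
    ∀ᶠ n : ℕ in atTop, (n : ℝ) * ‖opT ^ (n + 1) - opT ^ n‖ ≤ 1 / Real.exp 1 + ε := by
  filter_upwards [tendsto_natCast_atTop_atTop.eventually (eventually_mul_norm_symbol_le hε),
    eventually_gt_atTop 0] with n hn hn0
  have hn0' : (0 : ℝ) < n := Nat.cast_pos.2 hn0
  set E : OpSymbol := NormedSpace.exp (pairA 0) with hE
  have hEmem : E ∈ fracAlgebra 0 := exp_mem_fracAlgebra (pairA_mem 0)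
  set p : OpSymbol := E ^ (n + 1) - E ^ n with hp
  have hmem : p ∈ fracAlgebra 0 := sub_mem (pow_mem hEmem _) (pow_mem hEmem _)
  have hfst : p.1 = opT ^ (n + 1) - opT ^ n := by
    rw [hp, Prod.fst_sub, Prod.pow_fst, Prod.pow_fst, hE, fst_exp_pairA]
  have hsnd : ‖p.2‖ ≤ (1 / Real.exp 1 + ε) / n := by
    refine (BoundedContinuousFunction.norm_le (by positivity)).2 fun ξ => ?_
    have hre := (symbol_re_pos (linePoint_re_pos 0 ξ)).le
    have e1 : p.2 ξ = Complex.exp (-symbol (linePoint 0 ξ)) ^ n *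
        (Complex.exp (-symbol (linePoint 0 ξ)) - 1) := by
      rw [hp, Prod.snd_sub, Prod.pow_snd, Prod.pow_snd, BoundedContinuousFunction.sub_apply,
        BoundedContinuousFunction.pow_apply, BoundedContinuousFunction.pow_apply, hE,
        snd_exp_opSymbol, pairA_snd]
      ring
    have h1 := norm_exp_sub_one_le_of_re_nonpos (z := -symbol (linePoint 0 ξ)) (by simpa using hre)
    rw [norm_neg] at h1
    rw [le_div_iff₀ hn0', mul_comm, e1, ← Complex.exp_nat_mul, norm_mul, Complex.norm_exp]
    refine le_trans ?_ (hn _ (one_le_linePoint_re 0 ξ))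
    refine mul_le_mul_of_nonneg_left ?_ hn0'.le
    rw [mul_comm]
    refine (mul_le_mul_of_nonneg_right h1 (Real.exp_pos _).le).trans (le_of_eq ?_)
    simp
  have h := norm_fst_le_of_mem hmem
  rw [hfst, NNReal.coe_zero, Real.exp_zero, one_mul] at h
  have := h.trans hsnd
  rwa [le_div_iff₀ hn0', mul_comm] at this

theorem limsup_coe_le_of_forall_eventually_le {ι : Type*} {f : Filter ι} {u : ι → ℝ} {a : ℝ}
    (h : ∀ ε > 0, ∀ᶠ i in f, u i ≤ a + ε) :
    limsup (fun i => (u i : EReal)) f ≤ (a : EReal) := by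
  by_contra! hlt
  obtain ⟨x, hx1, hx2⟩ := EReal.lt_iff_exists_real_btwn.1 hlt
  have hx : a < x := EReal.coe_lt_coe_iff.1 hx1
  refine hx2.not_ge (limsup_le_of_le (h := ?_))
  filter_upwards [h (x - a) (sub_pos.2 hx)] with i hi
  exact EReal.coe_le_coe_iff.2 (by linarith)

/-! ### Spectra and the case `T = 1` -/

theorem spectrum_eq_singleton_zero_of_norm_pow_le {𝔸 : Type*} [NormedRing 𝔸] [NormedAlgebra ℂ 𝔸]
    [CompleteSpace 𝔸] [NormOneClass 𝔸] {a : 𝔸}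
    (h : ∀ ε > 0, ∃ C : ℝ, ∀ n : ℕ, ‖a ^ n‖ ≤ C * ε ^ n) : spectrum ℂ a = {0} := by
  have : Nontrivial 𝔸 := NormOneClass.nontrivial
  refine (Set.Nonempty.subset_singleton_iff (spectrum.nonempty a)).1 fun k hk => ?_
  rw [Set.mem_singleton_iff]
  by_contra hne
  have hk0 : 0 < ‖k‖ := norm_pos_iff.2 hne
  -- As `k ^ n` lies in the spectrum of `a ^ n`, this rate forces `1 ≤ C 2 ^ (-n)` for all `n`.
  obtain ⟨C, hC⟩ := h (‖k‖ / 2) (half_pos hk0)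
  have h1 : ∀ n : ℕ, 1 ≤ C * (1 / 2 : ℝ) ^ n := fun n => by
    have h2 := (spectrum.norm_le_norm_of_mem (spectrum.pow_mem_pow a n hk)).trans (hC n)
    rw [norm_pow, div_eq_mul_one_div, mul_pow] at h2
    have h3 : 0 < ‖k‖ ^ n := by positivity
    nlinarith
  have hlim : Tendsto (fun n : ℕ => C * (1 / 2 : ℝ) ^ n) atTop (𝓝 0) := by
    simpa using (tendsto_pow_atTop_nhds_zero_of_lt_one (r := (1 / 2 : ℝ)) (by norm_num)
      (by norm_num)).const_mul C
  linarith [ge_of_tendsto' hlim h1]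

theorem exists_norm_symbol_le {ε : ℝ} (hε : 0 < ε) :
    ∃ l : ℝ≥0, ∀ ξ, ‖symbol (linePoint l ξ)‖ ≤ ε := by
  -- With `l = e ^ (1/ε)` one has `log |w| ≥ 1/ε` on the whole line, and `expMean_mul_le` then gives
  -- `expMean ≤ ε`.
  refine ⟨(Real.exp (1 / ε)).toNNReal, fun ξ => ?_⟩
  set l : ℝ≥0 := (Real.exp (1 / ε)).toNNReal with hl
  refine (norm_symbol_le (linePoint_re_pos l ξ)).trans ?_
  have h1 : 1 / ε ≤ Real.log ‖linePoint l ξ‖ := by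
    have h2 : Real.exp (1 / ε) ≤ ‖linePoint l ξ‖ := by
      refine le_trans ?_ ((le_abs_self _).trans (Complex.abs_re_le_norm _))
      rw [linePoint_re, hl, Real.coe_toNNReal _ (Real.exp_pos _).le]
      linarith
    exact (Real.le_log_iff_exp_le ((Real.exp_pos _).trans_le h2)).2 h2
  have h3 := expMean_mul_le (Real.log ‖linePoint l ξ‖)
  have h4 := expMean_pos (Real.log ‖linePoint l ξ‖)
  have h5 : 1 / ε * expMean (Real.log ‖linePoint l ξ‖) ≤ 1 :=
    (mul_le_mul_of_nonneg_right h1 h4.le).trans h3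
  rwa [one_div, inv_mul_le_iff₀ hε, mul_one] at h5

/-- The line is chosen from `ε` alone, so `e ^ l` serves as `C` for every power. Applied to both `A`
and `T - 1`. -/
theorem exists_norm_pow_le {a : L2 →L[ℂ] L2} {p : ℝ≥0 → OpSymbol}
    (hmem : ∀ l, p l ∈ fracAlgebra l) (hfst : ∀ l, (p l).1 = a)
    (hsnd : ∀ l ξ, ‖(p l).2 ξ‖ ≤ ‖symbol (linePoint l ξ)‖) {ε : ℝ} (hε : 0 < ε) :
    ∃ C : ℝ, ∀ n : ℕ, ‖a ^ n‖ ≤ C * ε ^ n := by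
  obtain ⟨l, hl⟩ := exists_norm_symbol_le hε
  refine ⟨Real.exp l, fun n => ?_⟩
  have h := norm_fst_le_of_mem (pow_mem (hmem l) n)
  rw [Prod.pow_fst, Prod.pow_snd, hfst] at h
  refine h.trans (mul_le_mul_of_nonneg_left ?_ (Real.exp_pos _).le)
  refine (norm_pow_le _ _).trans (pow_le_pow_left₀ (norm_nonneg _) ?_ n)
  exact (BoundedContinuousFunction.norm_le hε.le).2 fun ξ => (hsnd l ξ).trans (hl ξ)

theorem nontrivial_L2 : Nontrivial L2 := by
  by_contra h
  rw [not_nontrivial_iff_subsingleton] at h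
  exact opA_ne_zero intervalIntegrable_frac (Subsingleton.elim _ _)

theorem spectrum_opA : spectrum ℂ opA = {0} := by
  have := nontrivial_L2
  refine spectrum_eq_singleton_zero_of_norm_pow_le fun ε hε =>
    exists_norm_pow_le (p := pairA) pairA_mem pairA_fst (fun l ξ => ?_) hε
  rw [pairA_snd, norm_neg]

theorem spectrum_opT : spectrum ℂ opT = {1} := by
  have := nontrivial_L2
  have h : spectrum ℂ (opT - 1) = {0} := by
    refine spectrum_eq_singleton_zero_of_norm_pow_le fun ε hε =>
      exists_norm_pow_le (p := fun l => NormedSpace.exp (pairA l) - 1)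
        (fun l => sub_mem (exp_mem_fracAlgebra (pairA_mem l)) (one_mem _))
        (fun l => by rw [Prod.fst_sub, fst_exp_pairA, Prod.fst_one]) (fun l ξ => ?_) hε
    have hre := (symbol_re_pos (linePoint_re_pos l ξ)).le
    have h1 := norm_exp_sub_one_le_of_re_nonpos (z := -symbol (linePoint l ξ)) (by simpa using hre)
    rw [norm_neg] at h1
    rw [Prod.snd_sub, BoundedContinuousFunction.sub_apply, snd_exp_opSymbol, pairA_snd]
    exact h1
  have h2 := spectrum.singleton_add_eq (R := ℂ) (opT - 1) (1 : ℂ)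
  rw [h, map_one, add_sub_cancel] at h2
  rw [← h2]
  simp

/-- If `e ^ A = 1`, then `e ^ (nA) = 1` and `n ‖A‖ = n ‖A e ^ (nA)‖` would stay bounded, although `A
≠ 0`. -/
theorem opT_ne_one : opT ≠ 1 := by
  intro hT
  have hexp : ∀ n : ℕ, NormedSpace.exp (((n : ℝ) : ℂ) • opA) = 1 := fun n => by
    let _ : NormedAlgebra ℚ (L2 →L[ℂ] L2) := NormedAlgebra.restrictScalars ℚ ℂ _
    rw [Complex.ofReal_natCast, Nat.cast_smul_eq_nsmul, NormedSpace.exp_nsmul]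
    change opT ^ n = 1
    rw [hT, one_pow]
  have hA : 0 < ‖opA‖ := norm_pos_iff.2 (opA_ne_zero intervalIntegrable_frac)
  have h1 := (tendsto_natCast_atTop_atTop (R := ℝ)).eventually
    (eventually_norm_mul_exp_le one_pos)
  have h2 := ((tendsto_natCast_atTop_atTop (R := ℝ)).atTop_mul_const hA).eventually_gt_atTop
    (1 / Real.exp 1 + 1)
  obtain ⟨n, hn1, hn2⟩ := (h1.and h2).exists
  rw [hexp n, mul_one] at hn1
  linarith

end ModVolterra

theorem theorem2p3 :
    -- the operator integral `∫_0^{1/2} L^α dα` converges absolutely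
    IntervalIntegrable ModVolterra.frac volume (0 : ℝ) (1 / 2) ∧
    -- continuous time: `A = -∫_0^{1/2} L^α dα`
    (ModVolterra.opA ≠ 0 ∧ spectrum ℂ ModVolterra.opA = {0} ∧
      limsup (fun t : ℝ =>
        ((t * ‖ModVolterra.opA * NormedSpace.exp ((t : ℂ) • ModVolterra.opA)‖ : ℝ) : EReal)) atTop
        ≤ ((1 / Real.exp 1 : ℝ) : EReal)) ∧
    -- discrete time: `T = e^A`
    (ModVolterra.opT ≠ 1 ∧ spectrum ℂ ModVolterra.opT = {1} ∧
      limsup (fun n : ℕ =>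
        (((n : ℝ) * ‖ModVolterra.opT ^ (n + 1) - ModVolterra.opT ^ n‖ : ℝ) : EReal)) atTop
        ≤ ((1 / Real.exp 1 : ℝ) : EReal)) ∧
    -- sharpness: `1/e` cannot be replaced by a larger constant, even on Hilbert spaces
    (∀ C : ℝ, 1 / Real.exp 1 < C →
      ¬ (∀ (H : Type) [NormedAddCommGroup H] [InnerProductSpace ℂ H] [CompleteSpace H]
          (A : H →L[ℂ] H), spectrum ℂ A = {0} →
          liminf (fun t : ℝ => ((t * ‖A * NormedSpace.exp ((t : ℂ) • A)‖ : ℝ) : EReal)) atTop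
            < (C : EReal) → A = 0) ∧
      ¬ (∀ (H : Type) [NormedAddCommGroup H] [InnerProductSpace ℂ H] [CompleteSpace H]
          (T : H →L[ℂ] H), spectrum ℂ T = {1} →
          liminf (fun n : ℕ => (((n : ℝ) * ‖T ^ (n + 1) - T ^ n‖ : ℝ) : EReal)) atTop
            < (C : EReal) → T = 1)) := by
  have hA := ModVolterra.limsup_coe_le_of_forall_eventually_le fun ε hε =>
    ModVolterra.eventually_norm_mul_exp_le (ε := ε) hε
  have hT := ModVolterra.limsup_coe_le_of_forall_eventually_le fun ε hε =>
    ModVolterra.eventually_norm_pow_sub_le (ε := ε) hε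
  have hA0 := ModVolterra.opA_ne_zero ModVolterra.intervalIntegrable_frac
  refine ⟨ModVolterra.intervalIntegrable_frac, ⟨hA0, ModVolterra.spectrum_opA, hA⟩,
    ⟨ModVolterra.opT_ne_one, ModVolterra.spectrum_opT, hT⟩, fun C hC => ⟨fun h => ?_, fun h => ?_⟩⟩
  · exact hA0 (h _ _ ModVolterra.spectrum_opA
      (((liminf_le_limsup).trans hA).trans_lt (EReal.coe_lt_coe_iff.2 hC)))
  · exact ModVolterra.opT_ne_one (h _ _ ModVolterra.spectrum_opT
      (((liminf_le_limsup).trans hT).trans_lt (EReal.coe_lt_coe_iff.2 hC)))
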